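/- Let $M\ge 1$, let $N\ge 2$ be even, let $0\le s\le M$, and assume $(M,N,s)\neq(1,2,1)$. Let $\Lambda_s\subseteq(\mathbb{C}^{M\times N})^2$ be the complex linear space of pairs of $M\times N$ matrices $\big((\alpha_0,\dots,\alpha_{N-1}),(\beta_0,\dots,\beta_{N-1})\big)$, with columns $\alpha_n,\beta_n\in\mathbb{C}^M$, whose first $s$ rows agree (the parameter space of pairs of $s$-overlapping $N$-element real frames, complexified). Let $V^1_M$ be the affine variety of complex symmetric $M\times M$ matrices of rank at most one. Let $$\mathcal{B}_{M,N,s}\subseteq \mathbb{P}(\Lambda_s)\times\mathbb{P}(V^1_M\times V^1_M)$$ be the quasi-projective variety of all points $([\alpha_0,\dots,\alpha_{N-1},\beta_0,\dots,\beta_{N-1}],[A,B])$ with $A\neq B$ satisfying $$\alpha_0^TA\alpha_0=\beta_0^TB\beta_0,\qquad \alpha_{N/2}^TA\alpha_{N/2}=\beta_{N/2}^TB\beta_{N/2},$$ $$\alpha_k^TA\alpha_k+\alpha_{N-k}^TA\alpha_{N-k}=\beta_k^TB\beta_k+\beta_{N-k}^TB\beta_{N-k}\qquad (1\le k\le N/2-1).$$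 Here $[A,B]$ is the class of the nonzero pair $(A,B)$ up to a common scalar. Then the dimension of $\mathcal{B}_{M,N,s}$ (its Krull dimension in the Zariski topology) is $$\dim\mathcal{B}_{M,N,s}=2MN+2M-\tfrac{N}{2}-sN-3.$$ -/

import Mathlib

open scoped LinearAlgebra.Projectivization

namespace OverlapIncidence

/-- A polynomial in two groups of variables is bihomogeneous of bidegree `(d, e)`. -/
def IsBihomogeneous {ι κ : Type*} (p : MvPolynomial (ι ⊕ κ) ℂ) (d e : ℕ) : Prop :=
  p.IsWeightedHomogeneous (Sum.elim 1 0 : ι ⊕ κ → ℕ) d ∧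
    p.IsWeightedHomogeneous (Sum.elim 0 1 : ι ⊕ κ → ℕ) e

/-- The set of points of a product of two complex projective spaces at which a polynomial in the
homogeneous coordinates does not vanish.  For bihomogeneous polynomials the choice of homogeneous
coordinates is irrelevant, see `mk_mem_nonvanishing`. -/
def nonvanishing {ι κ : Type*} (p : MvPolynomial (ι ⊕ κ) ℂ) :
    Set (ℙ ℂ (ι → ℂ) × ℙ ℂ (κ → ℂ)) :=
  {P | MvPolynomial.eval (Sum.elim P.1.rep P.2.rep) p ≠ 0}

/-- The Zariski topology on a product of two complex projective spaces: the open sets are the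
unions of nonvanishing loci of bihomogeneous polynomials (such loci are stable under finite
intersections), so the closed sets are the common zero loci of families of such polynomials. -/
abbrev zariskiTopology (ι κ : Type*) : TopologicalSpace (ℙ ℂ (ι → ℂ) × ℙ ℂ (κ → ℂ)) :=
  TopologicalSpace.generateFrom
    {U | ∃ (p : MvPolynomial (ι ⊕ κ) ℂ) (d e : ℕ), IsBihomogeneous p d e ∧ U = nonvanishing p}

/-- The dimension of a subset of a product of two projective spaces: the supremum of the lengths
of chains of irreducible closed subsets, in the induced Zariski topology (`⊥` if it is empty). -/
noncomputable def zariskiDim {ι κ : Type*} (X : Set (ℙ ℂ (ι → ℂ) × ℙ ℂ (κ → ℂ))) :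
    WithBot ℕ∞ :=
  @topologicalKrullDim X ((zariskiTopology ι κ).induced Subtype.val)

/-- Coordinates on pairs of `M × N` matrices: `Sum.inl (n, j)` is the `j`-th entry of the `n`-th
column of the first matrix, `Sum.inr (n, j)` the same entry of the second matrix. -/
abbrev FrameCoord (M N : ℕ) : Type := (Fin N × Fin M) ⊕ (Fin N × Fin M)

/-- Coordinates on pairs of `M × M` matrices. -/
abbrev MatCoord (M : ℕ) : Type := (Fin M × Fin M) ⊕ (Fin M × Fin M)

/-- The `n`-th vector `αₙ` of the first frame. -/
def alpha {M N : ℕ} (x : FrameCoord M N → ℂ) (n : Fin N) : Fin M → ℂ :=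
  fun j => x (Sum.inl (n, j))

/-- The `n`-th vector `βₙ` of the second frame. -/
def beta {M N : ℕ} (x : FrameCoord M N → ℂ) (n : Fin N) : Fin M → ℂ :=
  fun j => x (Sum.inr (n, j))

/-- The first matrix of a pair. -/
def matA {M : ℕ} (y : MatCoord M → ℂ) : Matrix (Fin M) (Fin M) ℂ :=
  Matrix.of fun i j => y (Sum.inl (i, j))

/-- The second matrix of a pair. -/
def matB {M : ℕ} (y : MatCoord M → ℂ) : Matrix (Fin M) (Fin M) ℂ :=
  Matrix.of fun i j => y (Sum.inr (i, j))

/-- The linear space `Λ_s` of pairs of complex `M × N` matrices whose first `s` rows agree. -/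
def overlapSpace (M N s : ℕ) : Submodule ℂ (FrameCoord M N → ℂ) where
  carrier := {x | ∀ (n : Fin N) (j : Fin M), (j : ℕ) < s → alpha x n j = beta x n j}
  add_mem' := by
    intro x y hx hy n j hj
    have h1 := hx n j hj
    have h2 := hy n j hj
    simp only [alpha, beta, Pi.add_apply] at h1 h2 ⊢
    rw [h1, h2]
  zero_mem' := by
    intro n j _
    simp [alpha, beta]
  smul_mem' := by
    intro c x hx n j hj
    have h1 := hx n j hj
    simp only [alpha, beta, Pi.smul_apply] at h1 ⊢
    rw [h1]

/-- The affine variety `V¹_M` of complex symmetric matrices of rank at most one. -/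
def symRankLeOne (M : ℕ) : Set (Matrix (Fin M) (Fin M) ℂ) :=
  {A | A.IsSymm ∧ A.rank ≤ 1}

/-- The quadratic form `u ↦ uᵀ A u`. -/
def quad {M : ℕ} (A : Matrix (Fin M) (Fin M) ℂ) (u : Fin M → ℂ) : ℂ :=
  u ⬝ᵥ A.mulVec u

/-- The defining equations of the incidence variety (for even `N`):
`α₀ᵀ A α₀ = β₀ᵀ B β₀`, `α_{N/2}ᵀ A α_{N/2} = β_{N/2}ᵀ B β_{N/2}`, and
`αₖᵀ A αₖ + α_{N-k}ᵀ A α_{N-k} = βₖᵀ B βₖ + β_{N-k}ᵀ B β_{N-k}` for `1 ≤ k ≤ N/2 - 1`. -/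
def IncidenceEqs {M N : ℕ} (x : FrameCoord M N → ℂ) (y : MatCoord M → ℂ) : Prop :=
  (∀ i : Fin N, (i : ℕ) = 0 → quad (matA y) (alpha x i) = quad (matB y) (beta x i)) ∧
  (∀ i : Fin N, (i : ℕ) = N / 2 → quad (matA y) (alpha x i) = quad (matB y) (beta x i)) ∧
  (∀ k l : Fin N, 1 ≤ (k : ℕ) → (k : ℕ) < N / 2 → (l : ℕ) = N - k →
    quad (matA y) (alpha x k) + quad (matA y) (alpha x l) =
      quad (matB y) (beta x k) + quad (matB y) (beta x l))

/-- The condition, on homogeneous coordinates `x = (α, β)` and `y = (A, B)`, for a point to lie in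
the incidence variety. -/
def InCone (M N s : ℕ) (x : FrameCoord M N → ℂ) (y : MatCoord M → ℂ) : Prop :=
  x ∈ overlapSpace M N s ∧ matA y ∈ symRankLeOne M ∧ matB y ∈ symRankLeOne M ∧
    matA y ≠ matB y ∧ IncidenceEqs x y

/-- The incidence variety `B_{M,N,s} ⊆ ℙ(Λ_s) × ℙ(V¹_M × V¹_M)`, as a subset of the product of
the ambient projective spaces of pairs of `M × N` matrices and of pairs of `M × M` matrices:
all `([α, β], [A, B])` with `A ≠ B` that satisfy the incidence equations.  The choice of
homogeneous coordinates is irrelevant, see `mk_mem_incidenceVariety`. -/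
def incidenceVariety (M N s : ℕ) :
    Set (ℙ ℂ (FrameCoord M N → ℂ) × ℙ ℂ (MatCoord M → ℂ)) :=
  {P | InCone M N s P.1.rep P.2.rep}

theorem eval_smul_smul {ι κ : Type*} {p : MvPolynomial (ι ⊕ κ) ℂ} {d e : ℕ}
    (hp : IsBihomogeneous p d e) (a b : ℂ) (x : ι → ℂ) (y : κ → ℂ) :
    MvPolynomial.eval (Sum.elim (a • x) (b • y)) p =
      a ^ d * b ^ e * MvPolynomial.eval (Sum.elim x y) p := by
  classical
  rw [MvPolynomial.eval_eq, MvPolynomial.eval_eq, Finset.mul_sum]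
  refine Finset.sum_congr rfl fun m hm => ?_
  have hm' := MvPolynomial.mem_support_iff.1 hm
  have h1 := hp.1 hm'
  have h2 := hp.2 hm'
  rw [Finsupp.weight_apply, Finsupp.sum] at h1 h2
  have key : ∀ i : ι ⊕ κ, (Sum.elim (a • x) (b • y) i) ^ m i =
      a ^ (m i • (Sum.elim 1 0 : ι ⊕ κ → ℕ) i) * b ^ (m i • (Sum.elim 0 1 : ι ⊕ κ → ℕ) i) *
        (Sum.elim x y i) ^ m i := by
    rintro (i | i) <;> simp [mul_pow]
  rw [Finset.prod_congr rfl fun i _ => key i, Finset.prod_mul_distrib, Finset.prod_mul_distrib,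
    Finset.prod_pow_eq_pow_sum, Finset.prod_pow_eq_pow_sum, h1, h2]
  ring

theorem mk_mem_nonvanishing {ι κ : Type*} {p : MvPolynomial (ι ⊕ κ) ℂ} {d e : ℕ}
    (hp : IsBihomogeneous p d e) {x : ι → ℂ} {y : κ → ℂ} (hx : x ≠ 0) (hy : y ≠ 0) :
    (Projectivization.mk ℂ x hx, Projectivization.mk ℂ y hy) ∈ nonvanishing p ↔
      MvPolynomial.eval (Sum.elim x y) p ≠ 0 := by
  obtain ⟨a, ha⟩ := Projectivization.exists_smul_eq_mk_rep ℂ x hx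
  obtain ⟨b, hb⟩ := Projectivization.exists_smul_eq_mk_rep ℂ y hy
  simp only [nonvanishing, Set.mem_ofPred_eq, ← ha, ← hb, Units.smul_def]
  rw [eval_smul_smul hp]
  simp

theorem inCone_smul_smul {M N s : ℕ} {a b : ℂ} (hb : b ≠ 0)
    {x : FrameCoord M N → ℂ} {y : MatCoord M → ℂ} (h : InCone M N s x y) :
    InCone M N s (a • x) (b • y) := by
  have hA : matA (b • y) = b • matA y := rfl
  have hB : matB (b • y) = b • matB y := rfl
  have hal : ∀ n, alpha (a • x) n = a • alpha x n := fun _ => rfl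
  have hbe : ∀ n, beta (a • x) n = a • beta x n := fun _ => rfl
  have hq : ∀ (C : Matrix (Fin M) (Fin M) ℂ) (u : Fin M → ℂ),
      quad (b • C) (a • u) = b * a ^ 2 * quad C u := by
    intro C u
    simp only [quad, Matrix.smul_mulVec, Matrix.mulVec_smul, dotProduct_smul, smul_dotProduct,
      smul_eq_mul]
    ring
  have hV : ∀ C ∈ symRankLeOne M, b • C ∈ symRankLeOne M := by
    rintro C ⟨h1, h2⟩
    refine ⟨h1.smul b, ?_⟩
    have h3 : b • C = Matrix.diagonal (fun _ => b) * C := by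
      ext i j
      simp [Matrix.diagonal_mul]
    rw [h3]
    exact (Matrix.rank_mul_le_right _ _).trans h2
  obtain ⟨hx, h1, h2, h3, e0, e1, e2⟩ := h
  refine ⟨Submodule.smul_mem _ _ hx, hA ▸ hV _ h1, hB ▸ hV _ h2, ?_, ?_, ?_, ?_⟩
  · rw [hA, hB]
    exact fun h => h3 (smul_right_injective _ hb h)
  · intro i hi
    rw [hA, hB, hal, hbe, hq, hq, e0 i hi]
  · intro i hi
    rw [hA, hB, hal, hbe, hq, hq, e1 i hi]
  · intro k l hk hk' hl
    rw [hA, hB, hal, hbe, hal, hbe, hq, hq, hq, hq, ← mul_add, ← mul_add, e2 k l hk hk' hl]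

theorem mk_mem_incidenceVariety {M N s : ℕ} {x : FrameCoord M N → ℂ} {y : MatCoord M → ℂ}
    (hx : x ≠ 0) (hy : y ≠ 0) :
    (Projectivization.mk ℂ x hx, Projectivization.mk ℂ y hy) ∈ incidenceVariety M N s ↔
      InCone M N s x y := by
  obtain ⟨a, ha⟩ := Projectivization.exists_smul_eq_mk_rep ℂ x hx
  obtain ⟨b, hb⟩ := Projectivization.exists_smul_eq_mk_rep ℂ y hy
  simp only [incidenceVariety, Set.mem_ofPred_eq, ← ha, ← hb, Units.smul_def]
  refine ⟨fun h => ?_, fun h => inCone_smul_smul b.ne_zero h⟩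
  have h' := inCone_smul_smul (a := (a : ℂ)⁻¹) (inv_ne_zero b.ne_zero) h
  rwa [inv_smul_smul₀ a.ne_zero, inv_smul_smul₀ b.ne_zero] at h'

end OverlapIncidence

open scoped Topology

namespace OverlapIncidence

/-! Write a column index `n` modulo `N`. All the equations take the form `q_A(α_n) + q_A(α_{-n}) =
q_B(β_n) + q_B(β_{-n})`, one for each of the `N/2 + 1` classes `{n, -n}`, and different classes
involve disjoint sets of frame entries. Since `Λ_s` has dimension `2MN - sN` and the pairs of
rank-one symmetric matrices have dimension `2M`, the expected dimension is `2MN - sN + 2M - (N/2 +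
1) - 2`, the last `2` coming from the two projective scalings. The proof establishes both
inequalities.

Upper bound. A chain of irreducible closed sets becomes, in an affine chart, a chain of primes, and
each strict inclusion yields one more algebraically independent element
(`algebraicIndependent_cons_of_ideal_lt`). So it suffices to bound the transcendence degree of a
generic point `(x, y)` of the bicone (`zariskiDim_le_of_trdeg_le`). The entries `y` of `A` and `B`
are rational in one row of each, giving at most `2M`. Over `ℂ(y)` each class gives a relation among
its own frame entries, nontrivial because `A ≠ B`, so a transcendence basis chosen among the frame
entries misses one in every class (`trdeg_add_le_of_incidence`).

Lower bound. Put `A = a aᵀ`, `B = b bᵀ` and, with `i² = -1`, `α_n = γ_n - i γ_{-n}`, `β_n = δ_n - i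
δ_{-n}`. The sum of two squares factors, and the equation becomes `(a·γ_n)(a·γ_{-n}) =
(b·δ_n)(b·δ_{-n})`, which for `n ≠ -n` is linear in the column `n`; for `n = -n` it suffices that
`a·γ_n = b·δ_n`. One entry per class is solved for, and setting one frame entry and one entry of `b`
to `1` removes the scalings. The remaining parameters are recovered well enough by bihomogeneous
equations to give a chain of closed sets of the required length (`card_le_zariskiDim`). -/

/-! ### Bihomogeneous polynomials and the Zariski topology of a product -/

theorem IsBihomogeneous.mul {ι κ : Type*} {p q : MvPolynomial (ι ⊕ κ) ℂ} {d e d' e' : ℕ}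
    (hp : IsBihomogeneous p d e) (hq : IsBihomogeneous q d' e') :
    IsBihomogeneous (p * q) (d + d') (e + e') :=
  ⟨hp.1.mul hq.1, hp.2.mul hq.2⟩

theorem IsBihomogeneous.add {ι κ : Type*} {p q : MvPolynomial (ι ⊕ κ) ℂ} {d e : ℕ}
    (hp : IsBihomogeneous p d e) (hq : IsBihomogeneous q d e) : IsBihomogeneous (p + q) d e :=
  ⟨hp.1.add hq.1, hp.2.add hq.2⟩

theorem isBihomogeneous_C {ι κ : Type*} (c : ℂ) :
    IsBihomogeneous (MvPolynomial.C c : MvPolynomial (ι ⊕ κ) ℂ) 0 0 :=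
  ⟨MvPolynomial.isWeightedHomogeneous_C _ _, MvPolynomial.isWeightedHomogeneous_C _ _⟩

theorem IsBihomogeneous.C_mul {ι κ : Type*} {p : MvPolynomial (ι ⊕ κ) ℂ} {d e : ℕ}
    (hp : IsBihomogeneous p d e) (c : ℂ) : IsBihomogeneous (MvPolynomial.C c * p) d e := by
  simpa using (isBihomogeneous_C c).mul hp

theorem isBihomogeneous_X_inl {ι κ : Type*} (i : ι) :
    IsBihomogeneous (MvPolynomial.X (Sum.inl i) : MvPolynomial (ι ⊕ κ) ℂ) 1 0 :=
  ⟨MvPolynomial.isWeightedHomogeneous_X _ _ _, MvPolynomial.isWeightedHomogeneous_X _ _ _⟩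

theorem isBihomogeneous_X_inr {ι κ : Type*} (j : κ) :
    IsBihomogeneous (MvPolynomial.X (Sum.inr j) : MvPolynomial (ι ⊕ κ) ℂ) 0 1 :=
  ⟨MvPolynomial.isWeightedHomogeneous_X _ _ _, MvPolynomial.isWeightedHomogeneous_X _ _ _⟩

theorem isOpen_nonvanishing {ι κ : Type*} {p : MvPolynomial (ι ⊕ κ) ℂ} {d e : ℕ}
    (hp : IsBihomogeneous p d e) : IsOpen[zariskiTopology ι κ] (nonvanishing p) :=
  TopologicalSpace.isOpen_generateFrom_of_mem ⟨p, d, e, hp, rfl⟩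

/-- The generating sets form a basis because the product of two bihomogeneous polynomials is
bihomogeneous and vanishes exactly where one factor does. -/
theorem exists_nonvanishing_subset {ι κ : Type*} {U : Set (ℙ ℂ (ι → ℂ) × ℙ ℂ (κ → ℂ))}
    (hU : IsOpen[zariskiTopology ι κ] U) {P : ℙ ℂ (ι → ℂ) × ℙ ℂ (κ → ℂ)} (hP : P ∈ U) :
    ∃ (p : MvPolynomial (ι ⊕ κ) ℂ) (d e : ℕ), IsBihomogeneous p d e ∧ P ∈ nonvanishing p ∧
      nonvanishing p ⊆ U := by
  induction hU with
  | basic U h =>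
    obtain ⟨p, d, e, hp, rfl⟩ := h
    exact ⟨p, d, e, hp, hP, subset_rfl⟩
  | univ => exact ⟨MvPolynomial.C 1, 0, 0, isBihomogeneous_C 1, by simp [nonvanishing], by simp⟩
  | inter U V _ _ hU hV =>
    obtain ⟨p, d, e, hp, hPp, hpU⟩ := hU hP.1
    obtain ⟨q, d', e', hq, hPq, hqV⟩ := hV hP.2
    refine ⟨p * q, _, _, hp.mul hq, ?_, ?_⟩
    · simpa [nonvanishing] using ⟨hPp, hPq⟩
    · intro Q hQ
      simp only [nonvanishing, Set.mem_ofPred_eq, map_mul, mul_ne_zero_iff] at hQ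
      exact ⟨hpU hQ.1, hqV hQ.2⟩
  | sUnion S _ ih =>
    obtain ⟨U, hUS, hPU⟩ := hP
    obtain ⟨p, d, e, hp, hPp, hpU⟩ := ih U hUS hPU
    exact ⟨p, d, e, hp, hPp, hpU.trans (Set.subset_sUnion_of_mem hUS)⟩

/-! ### Lower bounds for the dimension from polynomial families -/

/-- Nonvanishing polynomials at points of a line do not vanish simultaneously at some point. -/
theorem exists_eval_lineMap_ne_zero {σ : Type*} {p q : MvPolynomial σ ℂ} {t u : σ → ℂ}
    (hp : MvPolynomial.eval t p ≠ 0) (hq : MvPolynomial.eval u q ≠ 0) :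
    ∃ z : ℂ, MvPolynomial.eval (fun a => t a + z * (u a - t a)) p ≠ 0 ∧
      MvPolynomial.eval (fun a => t a + z * (u a - t a)) q ≠ 0 := by
  let line : MvPolynomial σ ℂ →ₐ[ℂ] Polynomial ℂ :=
    MvPolynomial.aeval fun a => Polynomial.C (t a) + Polynomial.X * Polynomial.C (u a - t a)
  have key : ∀ (z : ℂ) (r : MvPolynomial σ ℂ), (line r).eval z =
      MvPolynomial.eval (fun a => t a + z * (u a - t a)) r := by
    intro z r
    induction r using MvPolynomial.induction_on with
    | C c => simp [line]
    | add p q hp hq => simp [hp, hq]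
    | mul_X p a hp => rw [map_mul, Polynomial.eval_mul, hp, map_mul]; simp [line]
  have h0 : line p ≠ 0 := fun h => hp (by simpa [h] using (key 0 p).symm)
  have h1 : line q ≠ 0 := fun h => hq (by simpa [h] using (key 1 q).symm)
  obtain ⟨z, hz⟩ : ∃ z, (line p * line q).eval z ≠ 0 := by
    by_contra! h
    exact mul_ne_zero h0 h1 (Polynomial.funext fun z => by simpa using h z)
  rw [Polynomial.eval_mul, key, key, mul_ne_zero_iff] at hz
  exact ⟨z, hz⟩

/-- A lower bound for the dimension: a polynomial family of points of `X`, such that the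
parameter values `t a = c a` are cut out by bihomogeneous equations. -/
theorem card_le_zariskiDim {ι κ σ : Type*} [Fintype σ]
    (X : Set (ℙ ℂ (ι → ℂ) × ℙ ℂ (κ → ℂ))) (g : ι ⊕ κ → MvPolynomial σ ℂ)
    (D : MvPolynomial σ ℂ) (c : σ → ℂ) (hc : MvPolynomial.eval c D ≠ 0)
    (hX : ∀ t : σ → ℂ, MvPolynomial.eval t D ≠ 0 →
      ∃ (hx : (fun i => MvPolynomial.eval t (g (Sum.inl i))) ≠ 0)
        (hy : (fun j => MvPolynomial.eval t (g (Sum.inr j))) ≠ 0),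
        (Projectivization.mk ℂ _ hx, Projectivization.mk ℂ _ hy) ∈ X)
    (htest : ∀ a : σ, ∃ (p : MvPolynomial (ι ⊕ κ) ℂ) (d e : ℕ), IsBihomogeneous p d e ∧
      ∀ t : σ → ℂ, MvPolynomial.eval t D ≠ 0 →
        (MvPolynomial.eval (fun v => MvPolynomial.eval t (g v)) p = 0 ↔ t a = c a)) :
    ((Fintype.card σ : ℕ) : WithBot ℕ∞) ≤ zariskiDim X := by
  classical
  let _ : TopologicalSpace (ℙ ℂ (ι → ℂ) × ℙ ℂ (κ → ℂ)) := zariskiTopology ι κ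
  let _ : TopologicalSpace X := (zariskiTopology ι κ).induced Subtype.val
  change _ ≤ topologicalKrullDim X
  let U := {t : σ → ℂ // MvPolynomial.eval t D ≠ 0}
  let φ : U → X := fun t => ⟨_, (hX t.1 t.2).choose_spec.choose_spec⟩
  have hφ : ∀ (t : U) (p : MvPolynomial (ι ⊕ κ) ℂ) (d e : ℕ), IsBihomogeneous p d e →
      ((φ t).1 ∈ nonvanishing p ↔
        MvPolynomial.eval t.1 (MvPolynomial.bind₁ g p) ≠ 0) := by
    intro t p d e hp
    rw [show MvPolynomial.eval t.1 (MvPolynomial.bind₁ g p) =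
      MvPolynomial.eval (fun v => MvPolynomial.eval t.1 (g v)) p from
        MvPolynomial.eval₂Hom_bind₁ _ _ _ _]
    refine (mk_mem_nonvanishing hp _ _).trans ?_
    rw [show Sum.elim (fun i => MvPolynomial.eval t.1 (g (Sum.inl i)))
      (fun j => MvPolynomial.eval t.1 (g (Sum.inr j))) =
        fun v => MvPolynomial.eval t.1 (g v) from funext fun v => by cases v <;> rfl]
  have hφ' : ∀ (t : U) (p : MvPolynomial (ι ⊕ κ) ℂ),
      MvPolynomial.eval t.1 (MvPolynomial.bind₁ g p) =
      MvPolynomial.eval (fun v => MvPolynomial.eval t.1 (g v)) p := fun t p =>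
        MvPolynomial.eval₂Hom_bind₁ _ _ _ _
  let e := Fintype.equivFin σ
  -- A flag of affine subspaces through `c`: only the first `k` parameters vary. The closures of the
  -- images form the chain.
  let L : ℕ → Set U := fun k => {t | ∀ a, k ≤ (e a : ℕ) → t.1 a = c a}
  have hbasic : ∀ (O : Set X), IsOpen O → ∀ t : U, φ t ∈ O →
      ∃ p : MvPolynomial σ ℂ, MvPolynomial.eval t.1 p ≠ 0 ∧
        ∀ u : U, MvPolynomial.eval u.1 p ≠ 0 → φ u ∈ O := by
    rintro O hO t ht
    obtain ⟨O', hO', rfl⟩ := isOpen_induced_iff.1 hO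
    obtain ⟨p, d, e, hp, h1, h2⟩ := exists_nonvanishing_subset hO' ht
    exact ⟨MvPolynomial.bind₁ g p, (hφ t p d e hp).1 h1, fun u hu => h2 ((hφ u p d e hp).2 hu)⟩
  have hirr : ∀ k, IsIrreducible (φ '' L k) := by
    intro k
    refine ⟨⟨φ ⟨c, hc⟩, ⟨c, hc⟩, fun _ _ => rfl, rfl⟩, ?_⟩
    rintro O O' hO hO' ⟨_, ⟨t, ht, rfl⟩, htO⟩ ⟨_, ⟨u, hu, rfl⟩, huO⟩
    obtain ⟨p, hp, hpO⟩ := hbasic O hO t htO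
    obtain ⟨q, hq, hqO⟩ := hbasic O' hO' u huO
    -- The line through two points of `L k` stays in the same affine subspace; the factor `D` keeps
    -- the chosen point in the parameter domain.
    obtain ⟨z, hz, hz'⟩ := exists_eval_lineMap_ne_zero (p := p * D) (q := q) (t := t.1) (u := u.1)
      (by simpa using ⟨hp, t.2⟩) hq
    rw [map_mul, mul_ne_zero_iff] at hz
    refine ⟨φ ⟨_, hz.2⟩, ⟨⟨_, hz.2⟩, ?_, rfl⟩, hpO ⟨_, hz.2⟩ hz.1, hqO ⟨_, hz.2⟩ hz'⟩
    intro a ha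
    simp [ht a ha, hu a ha]
  let Z : ℕ → TopologicalSpace.IrreducibleCloseds X := fun k =>
    ⟨closure (φ '' L k), (hirr k).closure, isClosed_closure⟩
  have hlt : ∀ k, k < Fintype.card σ → Z k < Z (k + 1) := by
    intro k hk
    refine lt_of_le_of_ne ?_ ?_
    · exact closure_mono (Set.image_mono fun t ht a ha => ht a (by omega))
    · intro heq
      obtain ⟨p, d, e', hp, htp⟩ := htest (e.symm ⟨k, hk⟩)
      let a := e.symm ⟨k, hk⟩
      have hea : (e a : ℕ) = k := by simp [a]
      let O : Set X := Subtype.val ⁻¹' nonvanishing p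
      have hO : IsOpen O := isOpen_induced (isOpen_nonvanishing hp)
      -- The test equation for the parameter `a` holds on all of `L k`, hence on the closure; moving
      -- `c` in the direction `a` leaves it.
      have hdis : closure (φ '' L k) ⊆ Oᶜ := by
        refine closure_minimal ?_ hO.isClosed_compl
        rintro _ ⟨t, ht, rfl⟩ hmem
        refine (hφ t p d e' hp).1 hmem ?_
        rw [hφ', htp t.1 t.2]
        exact ht a hea.ge
      obtain ⟨z, hz, hz'⟩ := exists_eval_lineMap_ne_zero (p := D)
        (q := MvPolynomial.X a - MvPolynomial.C (c a)) (t := c)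
        (u := fun b => if b = a then c a + 1 else c b) hc (by simp)
      let t : U := ⟨_, hz⟩
      have htL : t ∈ L (k + 1) := by
        intro b hb
        have : b ≠ a := by rintro rfl; omega
        simp [t, this]
      have hmem : φ t ∈ closure (φ '' L k) := by
        have : φ t ∈ Z (k + 1) := subset_closure ⟨t, htL, rfl⟩
        rw [← heq] at this
        exact this
      refine hdis hmem ((hφ t p d e' hp).2 ?_)
      rw [hφ', Ne, htp t.1 t.2]
      intro h
      apply hz'
      rw [map_sub, MvPolynomial.eval_X, MvPolynomial.eval_C]
      exact sub_eq_zero.2 h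
  rw [topologicalKrullDim, Order.le_krullDim_iff]
  exact ⟨⟨Fintype.card σ, fun i => Z i, fun i => by simpa using hlt i i.2⟩, rfl⟩

/-! ### Upper bounds for the dimension from generic points -/

/-- Enlarging a prime ideal strictly lowers the number of independent elements of the quotient. -/
theorem algebraicIndependent_cons_of_ideal_lt {k R : Type*} [Field k] [CommRing R] [Algebra k R]
    {P Q : Ideal R} [P.IsPrime] [Q.IsPrime] (hPQ : P < Q) {n : ℕ} {f : Fin n → R}
    (hf : AlgebraicIndependent k fun i => Ideal.Quotient.mk Q (f i)) :
    ∃ g : Fin (n + 1) → R, AlgebraicIndependent k fun i => Ideal.Quotient.mk P (g i) := by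
  obtain ⟨b, hbQ, hbP⟩ := SetLike.exists_of_lt hPQ
  let π : (R ⧸ P) →ₐ[k] (R ⧸ Q) := Ideal.Quotient.factorₐ k hPQ.le
  have hπ : ∀ r, π (Ideal.Quotient.mk P r) = Ideal.Quotient.mk Q r := fun r => rfl
  have hfP : AlgebraicIndependent k fun i => Ideal.Quotient.mk P (f i) :=
    AlgebraicIndependent.of_comp π hf
  have hb : Transcendental (Algebra.adjoin k (Set.range fun i => Ideal.Quotient.mk P (f i)))
      (Ideal.Quotient.mk P b) := by
    intro halg
    -- Since `b` is nonzero modulo `P`, an algebraic relation may be taken with nonzero constant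
    -- term. Modulo `Q` the element `b` vanishes, so the constant term becomes a relation among the
    -- `f i`, a contradiction.
    obtain ⟨q, hq0, hq⟩ := halg.exists_nonzero_coeff_and_aeval_eq_zero
      (mem_nonZeroDivisors_of_ne_zero fun h => hbP (Ideal.Quotient.eq_zero_iff_mem.1 h))
    obtain ⟨r, hr⟩ : ∃ r, MvPolynomial.aeval (fun i => Ideal.Quotient.mk P (f i)) r =
        (q.coeff 0 : R ⧸ P) := by
      exact (Algebra.adjoin_range_eq_range_aeval k
        (fun i => Ideal.Quotient.mk P (f i))).le (q.coeff 0).2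
    have h1 : π (q.coeff 0 : R ⧸ P) = 0 := by
      have h2 := congrArg π hq
      rw [Polynomial.aeval_eq_sum_range, Finset.sum_range_succ', map_add, map_sum,
        Finset.sum_eq_zero] at h2
      · simpa [Algebra.smul_def] using h2
      · intro i _
        rw [Algebra.smul_def, map_mul, map_pow, hπ, Ideal.Quotient.eq_zero_iff_mem.2 hbQ,
          zero_pow i.succ_ne_zero, mul_zero]
    have h2 : MvPolynomial.aeval (fun i => Ideal.Quotient.mk Q (f i)) r = 0 := by
      rw [← h1, ← hr, ← AlgHom.comp_apply, MvPolynomial.comp_aeval]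
      rfl
    have h3 : r = 0 := (algebraicIndependent_iff.1 hf) r h2
    rw [h3, map_zero] at hr
    exact hq0 (Subtype.ext hr.symm)
  have h1 := (hfP.option_iff_transcendental _).2 hb
  refine ⟨fun i => (finSuccEquiv n i).elim b f, ?_⟩
  convert h1.comp _ (finSuccEquiv n).injective using 1
  ext i
  simp only [Function.comp]
  cases finSuccEquiv n i <;> rfl

/-- The two new variables will serve as independent scaling factors for the two projective
coordinates. -/
theorem add_two_le_trdeg_fractionRing (D : Type) [CommRing D] [IsDomain D] [Algebra ℂ D] :
    Algebra.trdeg ℂ D + 2 ≤ Algebra.trdeg ℂ (FractionRing (MvPolynomial Bool D)) := by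
  have h1 := trdeg_add_eq ℂ D (A := FractionRing (MvPolynomial Bool D))
  have h2 := trdeg_add_eq D (MvPolynomial Bool D) (A := FractionRing (MvPolynomial Bool D))
  rw [MvPolynomial.trdeg_of_isDomain] at h2
  simp only [Cardinal.mk_fintype, Fintype.card_bool, Nat.cast_ofNat, Cardinal.lift_ofNat] at h2
  rw [← h1, ← h2, ← add_assoc]
  exact le_self_add

theorem aeval_smul_smul {ι κ K : Type*} [Field K] [Algebra ℂ K] {p : MvPolynomial (ι ⊕ κ) ℂ}
    {d e : ℕ} (hp : IsBihomogeneous p d e) (a b : K) (x : ι → K) (y : κ → K) :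
    MvPolynomial.aeval (Sum.elim (a • x) (b • y)) p =
      a ^ d * b ^ e * MvPolynomial.aeval (Sum.elim x y) p := by
  classical
  rw [MvPolynomial.aeval_eq_eval₂Hom, MvPolynomial.coe_eval₂Hom, MvPolynomial.eval₂_eq,
    MvPolynomial.aeval_eq_eval₂Hom, MvPolynomial.coe_eval₂Hom, MvPolynomial.eval₂_eq,
    Finset.mul_sum]
  refine Finset.sum_congr rfl fun m hm => ?_
  have hm' := MvPolynomial.mem_support_iff.1 hm
  have h1 := hp.1 hm'
  have h2 := hp.2 hm'
  rw [Finsupp.weight_apply, Finsupp.sum] at h1 h2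
  have key : ∀ i : ι ⊕ κ, (Sum.elim (a • x) (b • y) i) ^ m i =
      a ^ (m i • (Sum.elim 1 0 : ι ⊕ κ → ℕ) i) * b ^ (m i • (Sum.elim 0 1 : ι ⊕ κ → ℕ) i) *
        (Sum.elim x y i) ^ m i := by
    rintro (i | i) <;> simp [mul_pow]
  rw [Finset.prod_congr rfl fun i _ => key i, Finset.prod_mul_distrib, Finset.prod_mul_distrib,
    Finset.prod_pow_eq_pow_sum, Finset.prod_pow_eq_pow_sum, h1, h2]
  ring

/-- Clearing denominators after dividing the coordinates by `x i` and by `y j`. -/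
theorem exists_homogenization {ι κ : Type*} (i : ι) (j : κ) (p : MvPolynomial (ι ⊕ κ) ℂ) :
    ∃ (q : MvPolynomial (ι ⊕ κ) ℂ) (d e : ℕ), IsBihomogeneous q d e ∧
      ∀ (x : ι → ℂ) (y : κ → ℂ), MvPolynomial.eval (Sum.elim x y) q ≠ 0 ↔
        (x i ≠ 0 ∧ y j ≠ 0) ∧
          MvPolynomial.eval (Sum.elim ((x i)⁻¹ • x) ((y j)⁻¹ • y)) p ≠ 0 := by
  -- Every sufficiently large bidegree is allowed, so that the summands of a sum can be homogenised
  -- to a common one.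
  have key : ∃ D E : ℕ, ∀ d e, D ≤ d → E ≤ e → ∃ q : MvPolynomial (ι ⊕ κ) ℂ,
      IsBihomogeneous q d e ∧ ∀ (x : ι → ℂ) (y : κ → ℂ), x i ≠ 0 → y j ≠ 0 →
        MvPolynomial.eval (Sum.elim x y) q = x i ^ d * y j ^ e *
          MvPolynomial.eval (Sum.elim ((x i)⁻¹ • x) ((y j)⁻¹ • y)) p := by
    have hpow : ∀ d e : ℕ, IsBihomogeneous (MvPolynomial.X (Sum.inl i) ^ d *
        MvPolynomial.X (Sum.inr j) ^ e : MvPolynomial (ι ⊕ κ) ℂ) d e := by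
      intro d e
      constructor
      · simpa using ((isBihomogeneous_X_inl (κ := κ) i).1.pow d).mul
          ((isBihomogeneous_X_inr (ι := ι) j).1.pow e)
      · simpa using ((isBihomogeneous_X_inl (κ := κ) i).2.pow d).mul
          ((isBihomogeneous_X_inr (ι := ι) j).2.pow e)
    induction p using MvPolynomial.induction_on with
    | C c =>
      refine ⟨0, 0, fun d e _ _ => ⟨_, (hpow d e).C_mul c, fun x y _ _ => ?_⟩⟩
      simp [mul_comm]
    | add p q hp hq =>
      obtain ⟨D, E, hp⟩ := hp
      obtain ⟨D', E', hq⟩ := hq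
      refine ⟨max D D', max E E', fun d e hd he => ?_⟩
      obtain ⟨p', hp1, hp2⟩ := hp d e (le_of_max_le_left hd) (le_of_max_le_left he)
      obtain ⟨q', hq1, hq2⟩ := hq d e (le_of_max_le_right hd) (le_of_max_le_right he)
      refine ⟨p' + q', hp1.add hq1, fun x y hx hy => ?_⟩
      rw [map_add, map_add, hp2 x y hx hy, hq2 x y hx hy, mul_add]
    | mul_X p v hp =>
      obtain ⟨D, E, hp⟩ := hp
      cases v with
      | inl v =>
        refine ⟨D + 1, E, fun d e hd he => ?_⟩
        obtain ⟨d, rfl⟩ : ∃ d', d = d' + 1 := ⟨d - 1, by omega⟩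
        obtain ⟨q, hq1, hq2⟩ := hp d e (by omega) he
        refine ⟨q * MvPolynomial.X (Sum.inl v), hq1.mul (isBihomogeneous_X_inl v),
          fun x y hx hy => ?_⟩
        rw [map_mul, map_mul, hq2 x y hx hy]
        simp only [MvPolynomial.eval_X, Sum.elim_inl, Pi.smul_apply, smul_eq_mul]
        field_simp
        ring
      | inr v =>
        refine ⟨D, E + 1, fun d e hd he => ?_⟩
        obtain ⟨e, rfl⟩ : ∃ e', e = e' + 1 := ⟨e - 1, by omega⟩
        obtain ⟨q, hq1, hq2⟩ := hp d e hd (by omega)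
        refine ⟨q * MvPolynomial.X (Sum.inr v), hq1.mul (isBihomogeneous_X_inr v),
          fun x y hx hy => ?_⟩
        rw [map_mul, map_mul, hq2 x y hx hy]
        simp only [MvPolynomial.eval_X, Sum.elim_inr, Pi.smul_apply, smul_eq_mul]
        field_simp
        ring
  obtain ⟨D, E, h⟩ := key
  obtain ⟨q, hq1, hq2⟩ := h D E le_rfl le_rfl
  -- The extra factor makes the polynomial vanish outside the chart, where the formula for `q` says
  -- nothing.
  refine ⟨_, _, _, hq1.mul ((isBihomogeneous_X_inl i).mul (isBihomogeneous_X_inr j)),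
    fun x y => ?_⟩
  simp only [map_mul, MvPolynomial.eval_X, Sum.elim_inl, Sum.elim_inr]
  by_cases hx : x i = 0
  · simp [hx]
  by_cases hy : y j = 0
  · simp [hy]
  rw [hq2 x y hx hy]
  simp [hx, hy]

/-- The point `(x, y)` over an extension field satisfies all bihomogeneous equations of `X`, and
specialises to some point of `X`. -/
def IsGenericPoint {ι κ K : Type*} [Field K] [Algebra ℂ K]
    (X : Set (ℙ ℂ (ι → ℂ) × ℙ ℂ (κ → ℂ))) (x : ι → K) (y : κ → K) : Prop :=
  (∀ (p : MvPolynomial (ι ⊕ κ) ℂ) (d e : ℕ), IsBihomogeneous p d e →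
      (∀ P ∈ X, MvPolynomial.eval (Sum.elim P.1.rep P.2.rep) p = 0) →
        MvPolynomial.aeval (Sum.elim x y) p = 0) ∧
    ∃ P ∈ X, ∀ (p : MvPolynomial (ι ⊕ κ) ℂ) (d e : ℕ), IsBihomogeneous p d e →
      MvPolynomial.aeval (Sum.elim x y) p = 0 →
        MvPolynomial.eval (Sum.elim P.1.rep P.2.rep) p = 0

/-- The quotient by a prime ideal gives, after adjoining two scaling parameters, a point over a
field whose transcendence degree is two larger. -/
theorem exists_scaled_point {ι κ : Type} {I : Ideal (MvPolynomial (ι ⊕ κ) ℂ)} [I.IsPrime]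
    {i : ι} {j : κ} (hi : MvPolynomial.X (Sum.inl i) - 1 ∈ I)
    (hj : MvPolynomial.X (Sum.inr j) - 1 ∈ I) :
    ∃ (K : Type) (_ : Field K) (_ : Algebra ℂ K) (x : ι → K) (y : κ → K),
      IntermediateField.adjoin ℂ (Set.range (Sum.elim x y)) = ⊤ ∧
      Algebra.trdeg ℂ (MvPolynomial (ι ⊕ κ) ℂ ⧸ I) + 2 ≤ Algebra.trdeg ℂ K ∧
      ∀ (p : MvPolynomial (ι ⊕ κ) ℂ) (d e : ℕ), IsBihomogeneous p d e →
        (MvPolynomial.aeval (Sum.elim x y) p = 0 ↔ p ∈ I) := by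
  let D := MvPolynomial (ι ⊕ κ) ℂ ⧸ I
  let S := MvPolynomial Bool D
  let K := FractionRing S
  let F : MvPolynomial (ι ⊕ κ) ℂ →ₐ[ℂ] K :=
    (IsScalarTower.toAlgHom ℂ D K).comp (Ideal.Quotient.mkₐ ℂ I)
  let a : K := algebraMap S K (MvPolynomial.X true)
  let b : K := algebraMap S K (MvPolynomial.X false)
  have hinj : Function.Injective (algebraMap S K) := IsFractionRing.injective S K
  have hDK : ∀ z : D, algebraMap D K z = algebraMap S K (MvPolynomial.C z) := fun z =>
    IsScalarTower.algebraMap_apply D S K z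
  have hF0 : ∀ p, F p = 0 ↔ p ∈ I := by
    intro p
    rw [show F p = algebraMap D K (Ideal.Quotient.mk I p) from rfl, hDK,
      map_eq_zero_iff _ hinj, map_eq_zero_iff _ (MvPolynomial.C_injective _ _),
      Ideal.Quotient.eq_zero_iff_mem]
  have ha : a ≠ 0 := (map_ne_zero_iff _ hinj).2 (MvPolynomial.X_ne_zero _)
  have hb : b ≠ 0 := (map_ne_zero_iff _ hinj).2 (MvPolynomial.X_ne_zero _)
  let x : ι → K := fun v => F (MvPolynomial.X (Sum.inl v))
  let y : κ → K := fun v => F (MvPolynomial.X (Sum.inr v))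
  have hxi : x i = 1 := by
    have := (hF0 _).2 hi
    rwa [map_sub, map_one, sub_eq_zero] at this
  have hyj : y j = 1 := by
    have := (hF0 _).2 hj
    rwa [map_sub, map_one, sub_eq_zero] at this
  have hF : MvPolynomial.aeval (Sum.elim x y) = F := by
    apply MvPolynomial.algHom_ext
    rintro (v | v) <;> simp [x, y]
  -- As `x i = y j = 1`, the scalars `a` and `b` are themselves coordinates of the scaled point, so
  -- its coordinates generate `K`; rescaling does not affect the vanishing of bihomogeneous
  -- polynomials.
  refine ⟨K, inferInstance, inferInstance, a • x, b • y, ?_, add_two_le_trdeg_fractionRing D, ?_⟩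
  · set E := IntermediateField.adjoin ℂ (Set.range (Sum.elim (a • x) (b • y))) with hE
    have hx : ∀ v, a * x v ∈ E := fun v => IntermediateField.subset_adjoin _ _ ⟨Sum.inl v, rfl⟩
    have hy : ∀ v, b * y v ∈ E := fun v => IntermediateField.subset_adjoin _ _ ⟨Sum.inr v, rfl⟩
    have haE : a ∈ E := by simpa [hxi] using hx i
    have hbE : b ∈ E := by simpa [hyj] using hy j
    have hFE : ∀ p, F p ∈ E := by
      intro p
      induction p using MvPolynomial.induction_on with
      | C c => rw [MvPolynomial.algHom_C]; exact E.algebraMap_mem c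
      | add p q hp hq => rw [map_add]; exact E.add_mem hp hq
      | mul_X p v hp =>
        rw [map_mul]
        refine E.mul_mem hp ?_
        cases v with
        | inl v =>
          have := E.mul_mem (E.inv_mem haE) (hx v)
          rwa [inv_mul_cancel_left₀ ha] at this
        | inr v =>
          have := E.mul_mem (E.inv_mem hbE) (hy v)
          rwa [inv_mul_cancel_left₀ hb] at this
    have hSE : ∀ p : S, algebraMap S K p ∈ E := by
      intro p
      induction p using MvPolynomial.induction_on with
      | C c =>
        obtain ⟨p, rfl⟩ := Ideal.Quotient.mk_surjective c
        rw [← hDK]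
        exact hFE p
      | add p q hp hq => rw [map_add]; exact E.add_mem hp hq
      | mul_X p v hp =>
        rw [map_mul]
        refine E.mul_mem hp ?_
        cases v
        · exact hbE
        · exact haE
    rw [eq_top_iff]
    intro z _
    obtain ⟨p, q, _, rfl⟩ := IsFractionRing.div_surjective S z
    exact E.div_mem (hSE p) (hSE q)
  · intro p d e hp
    rw [aeval_smul_smul hp, hF, ← hF0]
    simp [ha, hb]

/-- An upper bound for the dimension, in terms of generic points of the affine cone. -/
theorem zariskiDim_le_of_trdeg_le {ι κ : Type} (X : Set (ℙ ℂ (ι → ℂ) × ℙ ℂ (κ → ℂ))) (d : ℕ)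
    (h : ∀ (K : Type) (_ : Field K) (_ : Algebra ℂ K) (x : ι → K) (y : κ → K),
      IsGenericPoint X x y → IntermediateField.adjoin ℂ (Set.range (Sum.elim x y)) = ⊤ →
        Algebra.trdeg ℂ K ≤ (d + 2 : ℕ)) :
    zariskiDim X ≤ d := by
  classical
  let _ : TopologicalSpace (ℙ ℂ (ι → ℂ) × ℙ ℂ (κ → ℂ)) := zariskiTopology ι κ
  let _ : TopologicalSpace X := (zariskiTopology ι κ).induced Subtype.val
  change topologicalKrullDim X ≤ _
  refine iSup_le fun l => ?_
  -- A point of the smallest member lies in every member, so a single chart around it meets the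
  -- whole chain.
  obtain ⟨P₀, hP₀⟩ := l.head.isIrreducible.nonempty
  obtain ⟨i, hi⟩ := Function.ne_iff.1 P₀.1.1.rep_nonzero
  obtain ⟨j, hj⟩ := Function.ne_iff.1 P₀.1.2.rep_nonzero
  let pt : X → ι ⊕ κ → ℂ := fun P =>
    Sum.elim ((P.1.1.rep i)⁻¹ • P.1.1.rep) ((P.1.2.rep j)⁻¹ • P.1.2.rep)
  let chart : Set X := {P | P.1.1.rep i ≠ 0 ∧ P.1.2.rep j ≠ 0}
  let I : TopologicalSpace.IrreducibleCloseds X → Ideal (MvPolynomial (ι ⊕ κ) ℂ) := fun Z =>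
    MvPolynomial.vanishingIdeal ℂ (pt '' (Z ∩ chart))
  have hI : ∀ Z p, p ∈ I Z ↔ ∀ P ∈ Z, P ∈ chart → MvPolynomial.eval (pt P) p = 0 := by
    intro Z p
    simp only [I, MvPolynomial.mem_vanishingIdeal_iff, Set.forall_mem_image]
    exact ⟨fun h P h1 h2 => h ⟨h1, h2⟩, fun h P hP => h P hP.1 hP.2⟩
  have hpt : ∀ (p : MvPolynomial (ι ⊕ κ) ℂ) (d e : ℕ), IsBihomogeneous p d e → ∀ P ∈ chart,
      (MvPolynomial.eval (pt P) p = 0 ↔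
        MvPolynomial.eval (Sum.elim P.1.1.rep P.1.2.rep) p = 0) := by
    intro p d e hp P hP
    rw [eval_smul_smul hp]
    simp [hP.1, hP.2]
  have hopen : ∀ p : MvPolynomial (ι ⊕ κ) ℂ,
      IsOpen {P : X | P ∈ chart ∧ MvPolynomial.eval (pt P) p ≠ 0} := by
    intro p
    obtain ⟨q, d, e, hq, hpq⟩ := exists_homogenization i j p
    convert isOpen_induced (isOpen_nonvanishing hq) using 1
    ext P
    exact (hpq _ _).symm
  have hopen' : IsOpen chart := by
    convert hopen 1 using 1
    ext P
    simp
  have hprime : ∀ Z, (∃ P ∈ Z, P ∈ chart) → (I Z).IsPrime := by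
    rintro Z ⟨P, hPZ, hPc⟩
    refine ⟨fun htop => ?_, fun {p q} hpq => ?_⟩
    · have : (1 : MvPolynomial (ι ⊕ κ) ℂ) ∈ I Z := htop ▸ Submodule.mem_top
      simpa using (hI Z 1).1 this P hPZ hPc
    · by_contra! hcon
      obtain ⟨h1, h2⟩ := hcon
      simp only [hI, not_forall] at h1 h2
      obtain ⟨P, hP, hPc, hPp⟩ := h1
      obtain ⟨Q, hQ, hQc, hQq⟩ := h2
      obtain ⟨R, hR, ⟨hRc, hRp⟩, -, hRq⟩ := Z.isIrreducible.2 _ _ (hopen p) (hopen q)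
        ⟨P, hP, hPc, hPp⟩ ⟨Q, hQ, hQc, hQq⟩
      have := (hI Z _).1 hpq R hR hRc
      rw [map_mul] at this
      exact mul_ne_zero hRp hRq this
  have hlt : ∀ Z Z', (∃ P ∈ Z, P ∈ chart) → Z < Z' → I Z' < I Z := by
    rintro Z Z' ⟨P, hPZ, hPc⟩ hZ
    refine lt_of_le_not_ge (fun p hp => (hI Z p).2 fun P hP => (hI Z' p).1 hp P (hZ.le hP)) ?_
    intro hle
    obtain ⟨Q, hQ', hQ⟩ := SetLike.exists_of_lt hZ
    obtain ⟨O, hO, hOZ⟩ := isOpen_induced_iff.1 Z.isClosed.isOpen_compl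
    have hmem : ∀ R : X, R.1 ∈ O ↔ R ∉ Z := fun R => by
      rw [← Set.mem_preimage, hOZ]
      rfl
    -- `p` vanishes on `Z` but not at `Q`, which may lie outside the chart; irreducibility of `Z'`
    -- supplies a point of the chart where `p` is nonzero.
    obtain ⟨p, d, e, hp, hpQ, hpO⟩ := exists_nonvanishing_subset hO ((hmem Q).2 hQ)
    have hpI : p ∈ I Z := by
      refine (hI Z p).2 fun R hR hRc => (hpt p d e hp R hRc).2 ?_
      by_contra hne
      exact (hmem R).1 (hpO hne) hR
    obtain ⟨R, hR, hRp, hRc⟩ := Z'.isIrreducible.2 _ _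
      (isOpen_induced (isOpen_nonvanishing hp)) hopen' ⟨Q, hQ', hpQ⟩ ⟨P, hZ.le hPZ, hPc⟩
    exact hRp ((hpt p d e hp R hRc).1 ((hI Z' p).1 (hle hpI) R hR hRc))
  have hchart : ∀ k, ∃ P ∈ l k, P ∈ chart := fun k =>
    ⟨P₀, (l.head_le k) hP₀, hi, hj⟩
  have hchain : ∀ k (hk : k < l.length + 1), ∃ f : Fin k → MvPolynomial (ι ⊕ κ) ℂ,
      AlgebraicIndependent ℂ fun v => Ideal.Quotient.mk (I (l ⟨k, hk⟩)) (f v) := by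
    intro k
    induction k with
    | zero =>
      intro hk
      have := hprime _ (hchart ⟨0, hk⟩)
      refine ⟨fun v => v.elim0, ?_⟩
      rw [algebraicIndependent_empty_type_iff]
      exact (algebraMap ℂ _).injective
    | succ k ih =>
      intro hk
      obtain ⟨f, hf⟩ := ih (by omega)
      have := hprime _ (hchart ⟨k, by omega⟩)
      have := hprime _ (hchart ⟨k + 1, hk⟩)
      exact algebraicIndependent_cons_of_ideal_lt
        (hlt _ _ (hchart _) (l.strictMono (Fin.mk_lt_mk.2 k.lt_succ_self))) hf
  obtain ⟨f, hf⟩ := hchain l.length (by omega)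
  -- The largest member carries `l.length` independent functions; its generic point, with the two
  -- scalings, has transcendence degree at least `l.length + 2`.
  set Z := l ⟨l.length, by omega⟩
  have hZc : ∃ P ∈ Z, P ∈ chart := hchart _
  have := hprime Z hZc
  have hi1 : (MvPolynomial.X (Sum.inl i) - 1 : MvPolynomial (ι ⊕ κ) ℂ) ∈ I Z := by
    refine (hI Z _).2 fun P hP hPc => ?_
    simp [pt, hPc.1]
  have hj1 : (MvPolynomial.X (Sum.inr j) - 1 : MvPolynomial (ι ⊕ κ) ℂ) ∈ I Z := by
    refine (hI Z _).2 fun P hP hPc => ?_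
    simp [pt, hPc.2]
  obtain ⟨K, _, _, x, y, htop, htr, hvan⟩ := exists_scaled_point hi1 hj1
  have hK := h K _ _ x y ⟨?_, ?_⟩ htop
  · have h1 := hf.lift_cardinalMk_le_trdeg
    have h2 := htr.trans hK
    simp only [Cardinal.mk_fintype, Fintype.card_fin, Cardinal.lift_uzero] at h1
    have h3 : ((l.length + 2 : ℕ) : Cardinal) ≤ (d + 2 : ℕ) := by
      refine le_trans ?_ h2
      push_cast
      gcongr
    have h4 : l.length ≤ d := by
      have := Nat.cast_le.1 h3
      omega
    exact_mod_cast h4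
  · intro p d e hp hpX
    refine (hvan p d e hp).2 ((hI Z p).2 fun P hP hPc => (hpt p d e hp P hPc).2 (hpX P.1 P.2))
  · obtain ⟨P, hP, hPc⟩ := hZc
    refine ⟨P.1, P.2, fun p d e hp h0 => ?_⟩
    exact (hpt p d e hp P hPc).1 ((hI Z p).1 ((hvan p d e hp).1 h0) P hP hPc)

/-! ### Transcendence degree of solutions of the incidence equations -/

theorem isAlgebraic_of_adjoin_eq_top {F K : Type*} [Field F] [Field K] [Algebra F K] {s : Set K}
    (hs : IntermediateField.adjoin F s = ⊤) : Algebra.IsAlgebraic (Algebra.adjoin F s) K := by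
  refine ⟨fun z => ?_⟩
  have hz : z ∈ IntermediateField.adjoin F s := hs ▸ IntermediateField.mem_top
  obtain ⟨a, ha, b, hb, rfl⟩ := IntermediateField.mem_adjoin_iff_div.1 hz
  rw [div_eq_mul_inv]
  exact (isAlgebraic_algebraMap (A := K) (⟨a, ha⟩ : Algebra.adjoin F s)).mul
    (isAlgebraic_algebraMap (A := K) (⟨b, hb⟩ : Algebra.adjoin F s)).inv

open scoped IntermediateField.algebraAdjoinAdjoin in
theorem trdeg_adjoin_range_le {F K σ : Type} [Field F] [Field K] [Algebra F K] [Fintype σ]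
    (v : σ → K) :
    Algebra.trdeg F (IntermediateField.adjoin F (Set.range v)) ≤ (Fintype.card σ : ℕ) := by
  let S := Algebra.adjoin F (Set.range v)
  let E := IntermediateField.adjoin F (Set.range v)
  have : Algebra.IsAlgebraic S E := IsFractionRing.isAlgebraic_iff' S S E |>.1 inferInstance
  have h1 := trdeg_add_eq F S (A := E)
  rw [trdeg_eq_zero (R := S), add_zero] at h1
  rw [← h1]
  have h2 := trdeg_le_of_surjective
    ((MvPolynomial.aeval v).rangeRestrict : MvPolynomial σ F →ₐ[F] _)
    (MvPolynomial.aeval v).rangeRestrict_surjective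
  rw [MvPolynomial.trdeg_of_isDomain] at h2
  rw [show S = (MvPolynomial.aeval v).range from Algebra.adjoin_range_eq_range_aeval F v]
  simpa using h2

/-- If the generators of `K` are divided into `m` classes, and no independent set of generators
contains a full class, then the transcendence degree drops by at least `m`. -/
theorem trdeg_add_le_card_of_dependent {F K V : Type} [Field F] [Field K] [Algebra F K] [Fintype V]
    (v : V → K) (hv : IntermediateField.adjoin F (Set.range v) = ⊤) {m : ℕ} (cls : V → ℕ)
    (hdep : ∀ T : Set V, AlgebraicIndependent F (fun w : T => v w) →
      ∀ g < m, ∃ w, cls w = g ∧ w ∉ T) :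
    Algebra.trdeg F K + m ≤ (Fintype.card V : ℕ) := by
  classical
  have := isAlgebraic_of_adjoin_eq_top hv
  obtain ⟨t, ht, hbasis⟩ := exists_isTranscendenceBasis_subset (R := F) (Set.range v)
  obtain ⟨T, hT⟩ := Set.exists_subset_bijOn (v ⁻¹' t) v
  rw [Set.image_preimage_eq_of_subset ht] at hT
  let e : T ≃ t := hT.2.equiv
  have hind : AlgebraicIndependent F (fun w : T => v w) := hbasis.1.comp e e.injective
  -- One generator missing from `T` is chosen in each class; these are distinct, and disjoint from
  -- the basis `T`, which gives the count.
  choose f hf hfT using fun g : Fin m => hdep T hind g g.2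
  have hinj : Function.Injective (Sum.elim (Subtype.val : T → V) f) := by
    refine Subtype.val_injective.sumElim ?_ ?_
    · intro a b hab
      ext
      rw [← hf a, ← hf b, hab]
    · rintro a b hab
      exact hfT b (hab ▸ a.2)
  have hcard := Fintype.card_le_of_injective _ hinj
  rw [Fintype.card_sum, Fintype.card_fin] at hcard
  rw [← hbasis.cardinalMk_eq_trdeg, ← Cardinal.mk_congr e, Cardinal.mk_fintype]
  exact_mod_cast hcard

/-- The entries of a symmetric matrix of rank at most one are rational in those of one row. -/
theorem exists_row_generating {F K : Type*} [Field F] [Field K] [Algebra F K] {M : ℕ}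
    (hM : 1 ≤ M) (A : Fin M → Fin M → K) (hsymm : ∀ i j, A i j = A j i)
    (hminor : ∀ i j k l, A i j * A k l = A i l * A k j) :
    ∃ i, ∀ k l, A k l ∈ IntermediateField.adjoin F (Set.range (A i)) := by
  -- By the minors `A k l ^ 2 = A k k * A l l`, so a zero diagonal means a zero matrix. Otherwise a
  -- row with `A i i ≠ 0` determines everything through `A k l = A i k * A i l / A i i`.
  by_cases h0 : ∀ i, A i i = 0
  · refine ⟨⟨0, hM⟩, fun k l => ?_⟩
    have h := hminor k l l k
    rw [h0, zero_mul, ← hsymm k l, mul_self_eq_zero] at h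
    rw [h]
    exact zero_mem _
  · push Not at h0
    obtain ⟨i, hi⟩ := h0
    refine ⟨i, fun k l => ?_⟩
    have h : A k l = A i k * A i l / A i i := by
      rw [eq_div_iff hi, hminor k l i i, hsymm k i]
    rw [h]
    exact div_mem (mul_mem (IntermediateField.subset_adjoin _ _ ⟨k, rfl⟩)
      (IntermediateField.subset_adjoin _ _ ⟨l, rfl⟩)) (IntermediateField.subset_adjoin _ _ ⟨i, rfl⟩)

/-- Two distinct symmetric matrices define distinct quadratic forms. -/
theorem exists_quad_ne {K : Type*} [Field K] [CharZero K] {M : ℕ} {A B : Fin M → Fin M → K}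
    (hA : ∀ i j, A i j = A j i) (hB : ∀ i j, B i j = B j i) (hne : ∃ i j, A i j ≠ B i j) :
    ∃ u : Fin M → K, ∑ i, ∑ j, A i j * u i * u j ≠ ∑ i, ∑ j, B i j * u i * u j := by
  classical
  by_contra! hcon
  obtain ⟨i, j, hij⟩ := hne
  have hs : ∀ (C : Fin M → Fin M → K) (k : Fin M),
      ∑ i, ∑ j, C i j * (Pi.single k 1 : Fin M → K) i * (Pi.single k 1 : Fin M → K) j = C k k := by
    intro C k
    simp [Pi.single_apply]
  have hp : ∀ (C : Fin M → Fin M → K) (k l : Fin M),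
      ∑ i, ∑ j, C i j * (Pi.single k 1 + Pi.single l 1 : Fin M → K) i *
        (Pi.single k 1 + Pi.single l 1 : Fin M → K) j = C k k + C k l + C l k + C l l := by
    intro C k l
    simp only [Pi.add_apply, Pi.single_apply, mul_add, add_mul, Finset.sum_add_distrib]
    simp
    ring
  have h1 := hcon (Pi.single i 1)
  have h2 := hcon (Pi.single j 1)
  have h3 := hcon (Pi.single i 1 + Pi.single j 1)
  rw [hs, hs] at h1 h2
  rw [hp, hp, h1, h2, hA j i, hB j i] at h3
  have h4 : (2 : K) * (A i j - B i j) = 0 := by linear_combination h3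
  rcases mul_eq_zero.1 h4 with h | h
  · exact two_ne_zero h
  · exact hij (sub_eq_zero.1 h)

/-- Coordinates on the overlap space: the entries of `β`, and the entries of `α` in the rows that
are not shared. -/
abbrev OverlapCoord (M N s : ℕ) : Type :=
  (Fin N × Fin M) ⊕ {p : Fin N × Fin M // s ≤ (p.2 : ℕ)}

/-- The row and column of a coordinate of the overlap space. -/
def OverlapCoord.pos {M N s : ℕ} (w : OverlapCoord M N s) : Fin N × Fin M :=
  Sum.elim id Subtype.val w

theorem card_overlapCoord {M N s : ℕ} (hs : s ≤ M) :
    Fintype.card (OverlapCoord M N s) = N * M + N * (M - s) := by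
  have e : {p : Fin N × Fin M // s ≤ (p.2 : ℕ)} ≃ Fin N × {j : Fin M // s ≤ (j : ℕ)} :=
    { toFun := fun p => (p.1.1, ⟨p.1.2, p.2⟩)
      invFun := fun p => ⟨(p.1, p.2.1), p.2.2⟩
      left_inv := fun _ => rfl
      right_inv := fun _ => rfl }
  have e' : {j : Fin M // s ≤ (j : ℕ)} ≃ Fin (M - s) :=
    { toFun := fun j => ⟨j.1 - s, by have := j.1.2; have := j.2; omega⟩
      invFun := fun j => ⟨⟨j + s, by omega⟩, by simp⟩
      left_inv := fun j => by ext; have := j.2; simp; omega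
      right_inv := fun j => by ext; simp }
  rw [Fintype.card_sum, Fintype.card_prod, Fintype.card_fin, Fintype.card_fin,
    Fintype.card_congr (e.trans (Equiv.prodCongr (Equiv.refl _) e')), Fintype.card_prod,
    Fintype.card_fin, Fintype.card_fin]

/-- The entry of `α` with given column and row, in coordinates of the overlap space. -/
def OverlapCoord.alphaIdx {M N : ℕ} (s : ℕ) (n : Fin N) (j : Fin M) : OverlapCoord M N s :=
  if h : s ≤ (j : ℕ) then Sum.inr ⟨(n, j), h⟩ else Sum.inl (n, j)

theorem OverlapCoord.pos_alphaIdx {M N : ℕ} (s : ℕ) (n : Fin N) (j : Fin M) :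
    (OverlapCoord.alphaIdx s n j).pos = (n, j) := by
  rw [OverlapCoord.alphaIdx]
  split_ifs <;> rfl

/-- The values of the coordinates on the overlap space at a pair of frames. -/
def OverlapCoord.val {M N s : ℕ} {K : Type*} (x : FrameCoord M N → K) (w : OverlapCoord M N s) :
    K :=
  Sum.elim (fun p => x (Sum.inr p)) (fun p => x (Sum.inl p.1)) w

theorem OverlapCoord.val_alphaIdx {M N s : ℕ} {K : Type*} {x : FrameCoord M N → K}
    (hx : ∀ (n : Fin N) (j : Fin M), (j : ℕ) < s → x (Sum.inl (n, j)) = x (Sum.inr (n, j)))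
    (n : Fin N) (j : Fin M) : (OverlapCoord.alphaIdx s n j).val x = x (Sum.inl (n, j)) := by
  rw [OverlapCoord.alphaIdx]
  split_ifs with h
  · rfl
  · exact (hx n j (not_le.1 h)).symm

/-- The incidence equation of the columns `±n` is a nontrivial relation between their entries. -/
theorem exists_notMem_of_algebraicIndependent {M N s : ℕ} [NeZero N] (hN2 : 2 ≤ N)
    {F K : Type*} [Field F] [CharZero F] [Field K] [Algebra F K] {A B : Fin M → Fin M → F}
    (hA : ∀ i j, A i j = A j i) (hB : ∀ i j, B i j = B j i) (hne : ∃ i j, A i j ≠ B i j)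
    {x : FrameCoord M N → K}
    (hx : ∀ (n : Fin N) (j : Fin M), (j : ℕ) < s → x (Sum.inl (n, j)) = x (Sum.inr (n, j)))
    (heq : ∀ n : Fin N,
      (∑ i, ∑ j, algebraMap F K (A i j) * x (Sum.inl (n, i)) * x (Sum.inl (n, j))) +
        ∑ i, ∑ j, algebraMap F K (A i j) * x (Sum.inl (-n, i)) * x (Sum.inl (-n, j)) =
      (∑ i, ∑ j, algebraMap F K (B i j) * x (Sum.inr (n, i)) * x (Sum.inr (n, j))) +
        ∑ i, ∑ j, algebraMap F K (B i j) * x (Sum.inr (-n, i)) * x (Sum.inr (-n, j)))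
    (T : Set (OverlapCoord M N s))
    (hT : AlgebraicIndependent F (fun w : T => OverlapCoord.val x w.1)) (g : ℕ)
    (hg : g < N / 2 + 1) :
    ∃ w : OverlapCoord M N s, min (w.pos.1 : ℕ) (N - w.pos.1) = g ∧ w ∉ T := by
  classical
  obtain ⟨u, hu⟩ := exists_quad_ne hA hB hne
  by_contra! hcls
  let n : Fin N := ⟨g, by omega⟩
  have hneg : ((-n : Fin N) : ℕ) = (N - g) % N := Fin.val_neg' n
  have hcls' : ∀ w : OverlapCoord M N s, w.pos.1 = n ∨ w.pos.1 = -n → w ∈ T := by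
    rintro w (h | h)
    · refine hcls w ?_
      rw [h]
      simp only [n]
      omega
    · refine hcls w ?_
      rw [h, hneg]
      rcases Nat.eq_zero_or_pos g with h0 | h0
      · simp [h0]
      · rw [Nat.mod_eq_of_lt (by omega)]
        omega
  let X' : OverlapCoord M N s → MvPolynomial T F := fun w =>
    if h : w ∈ T then MvPolynomial.X ⟨w, h⟩ else 0
  have hX : ∀ w : OverlapCoord M N s, w.pos.1 = n ∨ w.pos.1 = -n →
      MvPolynomial.aeval (fun w : T => OverlapCoord.val x w.1) (X' w) = w.val x := by
    intro w hw
    simp [X', hcls' w hw]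
  -- The test point has column `n` equal to `u` in both frames, which respects the shared rows, and
  -- zeros elsewhere. There the relation takes a nonzero value because `u` separates the two forms.
  let z : T → F := fun w => if w.1.pos.1 = n then u w.1.pos.2 else 0
  have hz : ∀ w : OverlapCoord M N s, w.pos.1 = n ∨ w.pos.1 = -n →
      MvPolynomial.eval z (X' w) = if w.pos.1 = n then u w.pos.2 else 0 := by
    intro w hw
    simp [X', hcls' w hw, z]
  let Q : Fin N → MvPolynomial T F := fun m =>
    (∑ i, ∑ j, MvPolynomial.C (A i j) * X' (OverlapCoord.alphaIdx s m i) *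
      X' (OverlapCoord.alphaIdx s m j)) -
    ∑ i, ∑ j, MvPolynomial.C (B i j) * X' (Sum.inl (m, i)) * X' (Sum.inl (m, j))
  have hQ : ∀ m, m = n ∨ m = -n → MvPolynomial.aeval (fun w : T => OverlapCoord.val x w.1) (Q m) =
      (∑ i, ∑ j, algebraMap F K (A i j) * x (Sum.inl (m, i)) * x (Sum.inl (m, j))) -
        ∑ i, ∑ j, algebraMap F K (B i j) * x (Sum.inr (m, i)) * x (Sum.inr (m, j)) := by
    intro m hm
    have h1 : ∀ j, MvPolynomial.aeval (fun w : T => OverlapCoord.val x w.1) (X' (OverlapCoord.alphaIdx s m j)) =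
        x (Sum.inl (m, j)) := fun j => by
      rw [hX _ (by rwa [OverlapCoord.pos_alphaIdx]), OverlapCoord.val_alphaIdx hx]
    have h2 : ∀ j, MvPolynomial.aeval (fun w : T => OverlapCoord.val x w.1) (X' (Sum.inl (m, j))) =
        x (Sum.inr (m, j)) := fun j => hX _ hm
    simp only [Q, map_sub, map_sum, map_mul, h1, h2, MvPolynomial.aeval_C]
  have hQz : ∀ m, m = n ∨ m = -n → MvPolynomial.eval z (Q m) = if m = n then
      (∑ i, ∑ j, A i j * u i * u j) - ∑ i, ∑ j, B i j * u i * u j else 0 := by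
    intro m hm
    have h1 : ∀ j, MvPolynomial.eval z (X' (OverlapCoord.alphaIdx s m j)) =
        if m = n then u j else 0 := fun j => by
      rw [hz _ (by rwa [OverlapCoord.pos_alphaIdx]), OverlapCoord.pos_alphaIdx]
    have h2 : ∀ j, MvPolynomial.eval z (X' (Sum.inl (m, j))) =
        if m = n then u j else 0 := fun j => hz _ hm
    simp only [Q, map_sub, map_sum, map_mul, h1, h2, MvPolynomial.eval_C]
    split_ifs <;> simp
  have hzero : Q n + Q (-n) = 0 := by
    refine (algebraicIndependent_iff.1 hT) _ ?_
    rw [map_add, hQ n (Or.inl rfl), hQ (-n) (Or.inr rfl)]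
    linear_combination heq n
  have hev := congrArg (MvPolynomial.eval z) hzero
  rw [map_add, hQz n (Or.inl rfl), hQz (-n) (Or.inr rfl), map_zero, if_pos rfl] at hev
  apply hu
  rw [← sub_eq_zero]
  -- If `-n = n` the value is counted twice, and characteristic zero allows halving.
  split_ifs at hev
  · exact self_eq_neg.1 (eq_neg_of_add_eq_zero_left hev)
  · rwa [add_zero] at hev

/-- The transcendence degree of a field generated by a solution of the incidence equations. -/
theorem trdeg_add_le_of_incidence {M N s : ℕ} [NeZero N] (hM : 1 ≤ M) (hN2 : 2 ≤ N)
    {K : Type} [Field K] [Algebra ℂ K] (x : FrameCoord M N → K) (y : MatCoord M → K)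
    (hx : ∀ (n : Fin N) (j : Fin M), (j : ℕ) < s → x (Sum.inl (n, j)) = x (Sum.inr (n, j)))
    (hAs : ∀ i j, y (Sum.inl (i, j)) = y (Sum.inl (j, i)))
    (hBs : ∀ i j, y (Sum.inr (i, j)) = y (Sum.inr (j, i)))
    (hA : ∀ i j k l, y (Sum.inl (i, j)) * y (Sum.inl (k, l)) =
      y (Sum.inl (i, l)) * y (Sum.inl (k, j)))
    (hB : ∀ i j k l, y (Sum.inr (i, j)) * y (Sum.inr (k, l)) =
      y (Sum.inr (i, l)) * y (Sum.inr (k, j)))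
    (hne : ∃ i j, y (Sum.inl (i, j)) ≠ y (Sum.inr (i, j)))
    (heq : ∀ n : Fin N,
      (∑ i, ∑ j, y (Sum.inl (i, j)) * x (Sum.inl (n, i)) * x (Sum.inl (n, j))) +
        ∑ i, ∑ j, y (Sum.inl (i, j)) * x (Sum.inl (-n, i)) * x (Sum.inl (-n, j)) =
      (∑ i, ∑ j, y (Sum.inr (i, j)) * x (Sum.inr (n, i)) * x (Sum.inr (n, j))) +
        ∑ i, ∑ j, y (Sum.inr (i, j)) * x (Sum.inr (-n, i)) * x (Sum.inr (-n, j)))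
    (htop : IntermediateField.adjoin ℂ (Set.range (Sum.elim x y)) = ⊤) :
    Algebra.trdeg ℂ K + (N / 2 + 1 : ℕ) ≤
      (2 * M + Fintype.card (OverlapCoord M N s) : ℕ) := by
  classical
  have : CharZero K := charZero_of_injective_algebraMap (algebraMap ℂ K).injective
  let F := IntermediateField.adjoin ℂ (Set.range y)
  obtain ⟨iA, hiA⟩ := exists_row_generating (F := ℂ) hM (fun i j => y (Sum.inl (i, j))) hAs hA
  obtain ⟨iB, hiB⟩ := exists_row_generating (F := ℂ) hM (fun i j => y (Sum.inr (i, j))) hBs hB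
  let r : Fin M ⊕ Fin M → K :=
    Sum.elim (fun j => y (Sum.inl (iA, j))) (fun j => y (Sum.inr (iB, j)))
  have hF : F = IntermediateField.adjoin ℂ (Set.range r) := by
    refine le_antisymm (IntermediateField.adjoin_le_iff.2 ?_) (IntermediateField.adjoin_le_iff.2 ?_)
    · rintro _ ⟨⟨i, j⟩ | ⟨i, j⟩, rfl⟩
      · exact IntermediateField.adjoin.mono _ _ _
          (by rintro _ ⟨j, rfl⟩; exact ⟨Sum.inl j, rfl⟩) (hiA i j)
      · exact IntermediateField.adjoin.mono _ _ _
          (by rintro _ ⟨j, rfl⟩; exact ⟨Sum.inr j, rfl⟩) (hiB i j)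
    · rintro _ ⟨j | j, rfl⟩
      · exact IntermediateField.subset_adjoin _ _ ⟨Sum.inl (iA, j), rfl⟩
      · exact IntermediateField.subset_adjoin _ _ ⟨Sum.inr (iB, j), rfl⟩
  have hFdeg : Algebra.trdeg ℂ F ≤ (2 * M : ℕ) := by
    rw [hF]
    refine (trdeg_adjoin_range_le r).trans ?_
    rw [Fintype.card_sum, Fintype.card_fin, two_mul]
  let v : OverlapCoord M N s → K := OverlapCoord.val x
  have hv : IntermediateField.adjoin F (Set.range v) = ⊤ := by
    rw [← IntermediateField.restrictScalars_eq_top_iff (K := ℂ), eq_top_iff, ← htop,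
      IntermediateField.adjoin_le_iff]
    have h1 : ∀ w, v w ∈ IntermediateField.adjoin F (Set.range v) := fun w =>
      IntermediateField.subset_adjoin _ _ ⟨w, rfl⟩
    have h2 : ∀ z : F, (z : K) ∈ IntermediateField.adjoin F (Set.range v) := fun z =>
      (IntermediateField.adjoin F (Set.range v)).algebraMap_mem z
    rintro _ ⟨w, rfl⟩
    rw [SetLike.mem_coe, IntermediateField.mem_restrictScalars]
    rcases w with (⟨n, j⟩ | p) | p
    · rw [Sum.elim_inl, ← OverlapCoord.val_alphaIdx hx]
      exact h1 _
    · exact h1 (Sum.inl p)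
    · exact h2 ⟨y p, IntermediateField.subset_adjoin _ _ ⟨p, rfl⟩⟩
  let A : Fin M → Fin M → F := fun i j =>
    ⟨y (Sum.inl (i, j)), IntermediateField.subset_adjoin _ _ ⟨_, rfl⟩⟩
  let B : Fin M → Fin M → F := fun i j =>
    ⟨y (Sum.inr (i, j)), IntermediateField.subset_adjoin _ _ ⟨_, rfl⟩⟩
  have hK := trdeg_add_le_card_of_dependent v hv (m := N / 2 + 1)
    (fun w => min (w.pos.1 : ℕ) (N - w.pos.1))
    (exists_notMem_of_algebraicIndependent hN2 (A := A) (B := B) (fun i j => Subtype.ext (hAs i j))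
      (fun i j => Subtype.ext (hBs i j))
      (by obtain ⟨i, j, h⟩ := hne; exact ⟨i, j, fun h' => h (congrArg Subtype.val h')⟩) hx heq)
  rw [← trdeg_add_eq ℂ F (A := K), add_assoc]
  exact (add_le_add hFdeg hK).trans_eq (Nat.cast_add _ _).symm

theorem quad_eq_sum {M : ℕ} (A : Matrix (Fin M) (Fin M) ℂ) (u : Fin M → ℂ) :
    quad A u = ∑ i, ∑ j, A i j * u i * u j := by
  simp only [quad, dotProduct, Matrix.mulVec, Finset.mul_sum]
  exact Finset.sum_congr rfl fun i _ => Finset.sum_congr rfl fun j _ => by ring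

/-- The incidence equations, in a form that is uniform in the column. -/
theorem incidenceEqs_iff {M N : ℕ} [NeZero N] (hN : Even N) (hN2 : 2 ≤ N)
    (x : FrameCoord M N → ℂ) (y : MatCoord M → ℂ) :
    IncidenceEqs x y ↔ ∀ n : Fin N,
      quad (matA y) (alpha x n) + quad (matA y) (alpha x (-n)) =
        quad (matB y) (beta x n) + quad (matB y) (beta x (-n)) := by
  have hval : ∀ n : Fin N, (n : ℕ) ≠ 0 → ((-n : Fin N) : ℕ) = N - n := fun n hn => by
    rw [Fin.val_neg', Nat.mod_eq_of_lt (by omega)]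
  have hN' : N / 2 + N / 2 = N := by
    obtain ⟨m, rfl⟩ := hN
    omega
  constructor
  · rintro ⟨h0, h1, h2⟩ n
    by_cases hn : (n : ℕ) = 0
    · have : -n = n := by
        have : n = 0 := Fin.ext hn
        rw [this, neg_zero]
      rw [this, h0 n hn]
    have hv := hval n hn
    rcases lt_trichotomy (n : ℕ) (N / 2) with h | h | h
    · exact h2 n (-n) (by omega) h hv
    · have : -n = n := Fin.ext (by omega)
      rw [this, h1 n h]
    · have := h2 (-n) n (by omega) (by omega) (by omega)
      rw [add_comm, this, add_comm]
  · intro h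
    have hself : ∀ n : Fin N, -n = n → quad (matA y) (alpha x n) = quad (matB y) (beta x n) := by
      intro n hn
      have := h n
      rw [hn, ← two_mul, ← two_mul] at this
      exact mul_left_cancel₀ two_ne_zero this
    refine ⟨fun n hn => hself n ?_, fun n hn => hself n ?_, fun k l hk hk' hl => ?_⟩
    · have : n = 0 := Fin.ext hn
      rw [this, neg_zero]
    · exact Fin.ext (by have := hval n (by omega); omega)
    · have : -k = l := Fin.ext (by have := hval k (by omega); omega)
      exact this ▸ h k

theorem minor_eq_of_rank_le_one {M : ℕ} {A : Matrix (Fin M) (Fin M) ℂ} (hA : A.rank ≤ 1)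
    (i j k l : Fin M) : A i j * A k l = A i l * A k j := by
  rw [Matrix.rank_eq_finrank_span_cols, finrank_le_one_iff] at hA
  obtain ⟨⟨w, hw⟩, h⟩ := hA
  have hc : ∀ j, ∃ c : ℂ, ∀ i, A i j = c * w i := by
    intro j
    obtain ⟨c, hc⟩ := h ⟨A.col j, Submodule.subset_span ⟨j, rfl⟩⟩
    exact ⟨c, fun i => (congrFun (congrArg Subtype.val hc) i).symm⟩
  obtain ⟨c, hc1⟩ := hc j
  obtain ⟨c', hc2⟩ := hc l
  rw [hc1, hc1, hc2, hc2]
  ring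

/-- All conditions except `A ≠ B` are bihomogeneous equations, rank at most one entering through its
`2 × 2` minors, so they pass to the generic point. -/
theorem zariskiDim_incidenceVariety_le {M N s : ℕ} [NeZero N] (hM : 1 ≤ M) (hN : Even N)
    (hN2 : 2 ≤ N) {d : ℕ}
    (hd : 2 * M + Fintype.card (OverlapCoord M N s) ≤ d + 2 + (N / 2 + 1)) :
    zariskiDim (incidenceVariety M N s) ≤ d := by
  refine zariskiDim_le_of_trdeg_le _ _ fun K _ _ x y ⟨hgen, P₀, hP₀, hspec⟩ htop => ?_
  have hcone : ∀ P ∈ incidenceVariety M N s, InCone M N s P.1.rep P.2.rep := fun P hP => hP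
  have hlin : ∀ u v : MatCoord M, IsBihomogeneous (MvPolynomial.X (Sum.inr u) +
      MvPolynomial.C (-1) * MvPolynomial.X (Sum.inr v) :
        MvPolynomial (FrameCoord M N ⊕ MatCoord M) ℂ) 0 1 := fun u v =>
    (isBihomogeneous_X_inr u).add ((isBihomogeneous_X_inr v).C_mul _)
  have hquad : ∀ u v u' v' : MatCoord M, IsBihomogeneous
      (MvPolynomial.X (Sum.inr u) * MvPolynomial.X (Sum.inr v) +
      MvPolynomial.C (-1) * (MvPolynomial.X (Sum.inr u') * MvPolynomial.X (Sum.inr v')) :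
        MvPolynomial (FrameCoord M N ⊕ MatCoord M) ℂ) 0 2 := fun u v u' v' =>
    ((isBihomogeneous_X_inr u).mul (isBihomogeneous_X_inr v)).add
      (((isBihomogeneous_X_inr u').mul (isBihomogeneous_X_inr v')).C_mul _)
  have hsymm : ∀ u v : MatCoord M, (∀ P ∈ incidenceVariety M N s, P.2.rep u = P.2.rep v) →
      y u = y v := by
    intro u v huv
    have := hgen _ _ _ (hlin u v) fun P hP => by simp [huv P hP]
    simpa [← sub_eq_add_neg, sub_eq_zero] using this
  have hminor : ∀ u v u' v' : MatCoord M, (∀ P ∈ incidenceVariety M N s,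
      P.2.rep u * P.2.rep v = P.2.rep u' * P.2.rep v') → y u * y v = y u' * y v' := by
    intro u v u' v' huv
    have := hgen _ _ _ (hquad u v u' v') fun P hP => by simp [huv P hP]
    simpa [← sub_eq_add_neg, sub_eq_zero] using this
  have hmain := trdeg_add_le_of_incidence (s := s) hM hN2 x y ?_
    (fun i j => hsymm _ _ fun P hP => (hcone P hP).2.1.1.apply j i)
    (fun i j => hsymm _ _ fun P hP => (hcone P hP).2.2.1.1.apply j i)
    (fun i j k l => hminor _ _ _ _ fun P hP => minor_eq_of_rank_le_one (hcone P hP).2.1.2 i j k l)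
    (fun i j k l => hminor _ _ _ _ fun P hP => minor_eq_of_rank_le_one (hcone P hP).2.2.1.2 i j k l)
    ?_ ?_ htop
  -- The bound makes the transcendence degree finite, so `N / 2 + 1` can be cancelled.
  · obtain ⟨m, hm⟩ := Cardinal.lt_aleph0.1
      ((le_self_add.trans hmain).trans_lt (Cardinal.natCast_lt_aleph0))
    rw [hm] at hmain ⊢
    have : m + (N / 2 + 1) ≤ 2 * M + Fintype.card (OverlapCoord M N s) := by exact_mod_cast hmain
    exact_mod_cast (by omega : m ≤ d + 2)
  · intro n j hj
    have := hgen _ _ _ ((isBihomogeneous_X_inl (κ := MatCoord M)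
      (Sum.inl (n, j) : FrameCoord M N)).add
        ((isBihomogeneous_X_inl (Sum.inr (n, j))).C_mul (-1))) fun P hP => by
          have h1 : P.1.rep (Sum.inl (n, j)) = P.1.rep (Sum.inr (n, j)) := (hcone P hP).1 n j hj
          simp [h1]
    simpa [← sub_eq_add_neg, sub_eq_zero] using this
  -- Inequality is an open condition: if `A = B` held at the generic point, it would hold at the
  -- specialisation `P₀` in the variety.
  · by_contra! h
    refine (hcone P₀ hP₀).2.2.2.1 (Matrix.ext fun i j => ?_)
    have := hspec _ _ _ (hlin (Sum.inl (i, j)) (Sum.inr (i, j))) (by simp [h i j])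
    simp only [map_add, map_mul, MvPolynomial.eval_X, MvPolynomial.eval_C, Sum.elim_inr] at this
    change P₀.2.rep (Sum.inl (i, j)) = P₀.2.rep (Sum.inr (i, j))
    linear_combination this
  · intro n
    have hbi : ∀ u v w, IsBihomogeneous (MvPolynomial.X (Sum.inr u) * MvPolynomial.X (Sum.inl v) *
        MvPolynomial.X (Sum.inl w) : MvPolynomial (FrameCoord M N ⊕ MatCoord M) ℂ) 2 1 :=
      fun u v w => ((isBihomogeneous_X_inr u).mul (isBihomogeneous_X_inl v)).mul
        (isBihomogeneous_X_inl w)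
    have hsum : ∀ (u : Fin M → Fin M → MatCoord M) (v : Fin M → FrameCoord M N), IsBihomogeneous
        (∑ i, ∑ j, MvPolynomial.X (Sum.inr (u i j)) * MvPolynomial.X (Sum.inl (v i)) *
          MvPolynomial.X (Sum.inl (v j)) : MvPolynomial (FrameCoord M N ⊕ MatCoord M) ℂ) 2 1 :=
      fun u v => ⟨MvPolynomial.IsWeightedHomogeneous.sum _ _ _ fun i _ =>
          MvPolynomial.IsWeightedHomogeneous.sum _ _ _ fun j _ => (hbi _ _ _).1,
        MvPolynomial.IsWeightedHomogeneous.sum _ _ _ fun i _ =>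
          MvPolynomial.IsWeightedHomogeneous.sum _ _ _ fun j _ => (hbi _ _ _).2⟩
    have := hgen _ _ _ (((hsum (fun i j => Sum.inl (i, j)) fun j => Sum.inl (n, j)).add
      (hsum (fun i j => Sum.inl (i, j)) fun j => Sum.inl (-n, j))).add
      (((hsum (fun i j => Sum.inr (i, j)) fun j => Sum.inr (n, j)).add
        (hsum (fun i j => Sum.inr (i, j)) fun j => Sum.inr (-n, j))).C_mul (-1))) fun P hP => by
          have h1 := (incidenceEqs_iff hN hN2 _ _).1 (hcone P hP).2.2.2.2 n
          simp only [quad_eq_sum, matA, matB, alpha, beta, Matrix.of_apply] at h1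
          simp [h1]
    simp only [map_add, map_sum, map_mul, map_neg, map_one, MvPolynomial.aeval_X,
      Sum.elim_inl, Sum.elim_inr] at this
    linear_combination this

/-! ### A parametrisation of solutions -/

/-- The columns in which one coordinate is determined by the incidence equations. -/
def IsDependent {N : ℕ} (n : Fin N) : Prop := (n : ℕ) = 0 ∨ N / 2 ≤ (n : ℕ)

instance {N : ℕ} (n : Fin N) : Decidable (IsDependent n) :=
  inferInstanceAs (Decidable (_ ∨ _))

/-- Each class `{n, -n}` contains exactly one dependent column: the self-paired `0` and `N / 2`, and
otherwise the member in the upper half. The other member of a pair stays free, so the equation is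
linear in the determined entry. -/
theorem isDependent_neg {N : ℕ} [NeZero N] (hN : Even N) {n : Fin N} :
    (¬ IsDependent n → IsDependent (-n)) ∧ (IsDependent n → -n ≠ n → ¬ IsDependent (-n)) := by
  have hN' : N / 2 + N / 2 = N := by
    obtain ⟨m, rfl⟩ := hN
    omega
  have h := n.2
  by_cases h0 : (n : ℕ) = 0
  · have hn : n = 0 := Fin.ext h0
    subst hn
    rw [neg_zero]
    exact ⟨fun h => absurd (Or.inl h0) h, fun _ h => absurd rfl h⟩
  have hv : ((-n : Fin N) : ℕ) = N - n := by
    rw [Fin.val_neg', Nat.mod_eq_of_lt (by omega)]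
  rw [Ne, Fin.ext_iff]
  unfold IsDependent
  omega

theorem card_filter_isDependent {N : ℕ} (hN : Even N) (hN2 : 2 ≤ N) :
    (Finset.univ.filter fun n : Fin N => IsDependent n).card = N / 2 + 1 := by
  have hN' : N / 2 + N / 2 = N := by
    obtain ⟨m, rfl⟩ := hN
    omega
  rw [← Finset.card_map Fin.valEmbedding, show (Finset.univ.filter fun n : Fin N =>
    IsDependent n).map Fin.valEmbedding = insert 0 (Finset.Ico (N / 2) N) from ?_,
    Finset.card_insert_of_notMem, Nat.card_Ico]
  · omega
  · simp
    omega
  · ext k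
    simp only [Finset.mem_map, Finset.mem_filter, Finset.mem_univ, true_and,
      Fin.valEmbedding_apply, Finset.mem_insert, Finset.mem_Ico]
    constructor
    · rintro ⟨n, h | h, rfl⟩
      · exact Or.inl h
      · exact Or.inr ⟨h, n.2⟩
    · intro h
      have hk : k < N := by omega
      exact ⟨⟨k, hk⟩, h.imp_right And.left, rfl⟩

/-- Parameters for solutions of the incidence equations: the free entries of the transformed
frames `x n + I * x (-n)`, and vectors `a`, `b` with `A = a aᵀ`, `B = b bᵀ`. -/
structure FrameData (M N s : ℕ) (S : Type*) where
  /-- The entries of the transformed frames, up to the determined ones. -/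
  coord : OverlapCoord M N s → S
  /-- The vector defining the first quadratic form. -/
  a : Fin M → S
  /-- The vector defining the second quadratic form. -/
  b : Fin M → S

namespace FrameData

variable {M N s : ℕ} {S S' : Type*} [CommRing S] [CommRing S']

/-- Base change of parameters. -/
def map (f : S →+* S') (p : FrameData M N s S) : FrameData M N s S' :=
  ⟨fun w => f (p.coord w), fun j => f (p.a j), fun j => f (p.b j)⟩

variable (l : Fin M) (p : FrameData M N s S)

/-- Entries of the first transformed frame, before solving the equations. -/
def freeA (n : Fin N) (j : Fin M) : S := p.coord (OverlapCoord.alphaIdx s n j)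

/-- Entries of the second transformed frame, before solving the equations. -/
def freeB (n : Fin N) (j : Fin M) : S := p.coord (Sum.inl (n, j))

/-- The factor of `a ⬝ᵥ γ n` in the incidence equation of column `n`. -/
def factorA (n : Fin N) : S := if -n = n then 1 else ∑ j, p.a j * p.freeA (-n) j

/-- The factor of `b ⬝ᵥ δ n` in the incidence equation of column `n`. -/
def factorB (n : Fin N) : S := if -n = n then 1 else ∑ j, p.b j * p.freeB (-n) j

/-- Whether the determined entry is shared by both frames. -/
def shared (s : ℕ) (S : Type*) [CommRing S] (l : Fin M) : S := if s ≤ (l : ℕ) then 0 else 1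

/-- The coefficient of the determined entry in the incidence equation of column `n`. -/
def pivot (n : Fin N) : S := p.factorB n * p.b l - shared s S l * p.factorA n * p.a l

/-- The value of the incidence equation of column `n` when the determined entry is zero. -/
def defect (n : Fin N) : S :=
  p.factorA n * (∑ j, p.a j * p.freeA n j) - p.factorB n * ∑ j, p.b j * p.freeB n j

/-- The first transformed frame. -/
def transA (n : Fin N) (j : Fin M) : S :=
  if IsDependent n then
    p.pivot l n * p.freeA n j + (if j = l then shared s S l * p.defect n else 0)
  else p.freeA n j

/-- The second transformed frame. -/
def transB (n : Fin N) (j : Fin M) : S :=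
  if IsDependent n then p.pivot l n * p.freeB n j + (if j = l then p.defect n else 0)
  else p.freeB n j

/-- The pair of frames with given parameters, where `i` is a square root of `-1`. -/
def frame (i : S) : FrameCoord M N → S :=
  Sum.elim (fun q => p.transA l q.1 q.2 - i * p.transA l (-q.1) q.2)
    (fun q => p.transB l q.1 q.2 - i * p.transB l (-q.1) q.2)

/-- The pair of matrices with given parameters. -/
def mats : MatCoord M → S :=
  Sum.elim (fun q => p.a q.1 * p.a q.2) (fun q => p.b q.1 * p.b q.2)

theorem map_pivot (f : S →+* S') (n : Fin N) : f (p.pivot l n) = (p.map f).pivot l n := by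
  simp [pivot, factorA, factorB, freeA, freeB, shared, map, apply_ite f]

theorem map_transA (f : S →+* S') (n : Fin N) (j : Fin M) :
    f (p.transA l n j) = (p.map f).transA l n j := by
  simp only [transA, apply_ite f, map_add, map_mul, map_pivot, map_zero]
  simp [defect, factorA, factorB, freeA, freeB, shared, map, apply_ite f]

theorem map_transB (f : S →+* S') (n : Fin N) (j : Fin M) :
    f (p.transB l n j) = (p.map f).transB l n j := by
  simp only [transB, apply_ite f, map_add, map_mul, map_pivot, map_zero]
  simp [defect, factorA, factorB, freeA, freeB, map, apply_ite f]

theorem map_frame (f : S →+* S') (i : S) (v : FrameCoord M N) :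
    f (p.frame l i v) = (p.map f).frame l (f i) v := by
  rcases v with q | q <;> simp [frame, map_transA, map_transB]

theorem map_mats (f : S →+* S') (v : MatCoord M) : f (p.mats v) = (p.map f).mats v := by
  rcases v with q | q <;> simp [mats, map]

/-- Cramer's rule without denominators: the determined entry would be `defect / pivot`, so the whole
column is multiplied by `pivot`. -/
theorem factorA_mul_sum {n : Fin N} (hn : IsDependent n) :
    p.factorA n * ∑ j, p.a j * p.transA l n j = p.factorB n * ∑ j, p.b j * p.transB l n j := by
  have hA : ∑ j, p.a j * p.transA l n j =
      p.pivot l n * (∑ j, p.a j * p.freeA n j) + p.a l * (shared s S l * p.defect n) := by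
    simp only [transA, if_pos hn, mul_add, Finset.sum_add_distrib, mul_ite, mul_zero,
      Finset.sum_ite_eq', Finset.mem_univ, if_true, Finset.mul_sum]
    exact congrArg₂ _ (Finset.sum_congr rfl fun j _ => by ring) rfl
  have hB : ∑ j, p.b j * p.transB l n j =
      p.pivot l n * (∑ j, p.b j * p.freeB n j) + p.b l * p.defect n := by
    simp only [transB, if_pos hn, mul_add, Finset.sum_add_distrib, mul_ite, mul_zero,
      Finset.sum_ite_eq', Finset.mem_univ, if_true, Finset.mul_sum]
    exact congrArg₂ _ (Finset.sum_congr rfl fun j _ => by ring) rfl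
  rw [hA, hB, defect, pivot]
  ring

theorem sum_mul_sum_neg [NeZero N] (hN : Even N) (n : Fin N) :
    (∑ j, p.a j * p.transA l n j) * (∑ j, p.a j * p.transA l (-n) j) =
      (∑ j, p.b j * p.transB l n j) * ∑ j, p.b j * p.transB l (-n) j := by
  have key : ∀ n : Fin N, IsDependent n →
      (∑ j, p.a j * p.transA l n j) * (∑ j, p.a j * p.transA l (-n) j) =
        (∑ j, p.b j * p.transB l n j) * ∑ j, p.b j * p.transB l (-n) j := by
    intro n hn
    have h := p.factorA_mul_sum l hn
    by_cases hnn : -n = n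
    · rw [factorA, factorB, if_pos hnn, if_pos hnn, one_mul, one_mul] at h
      rw [hnn, h]
    · have hneg := (isDependent_neg hN).2 hn hnn
      rw [factorA, factorB, if_neg hnn, if_neg hnn] at h
      have hA : ∀ j, p.transA l (-n) j = p.freeA (-n) j := fun j => if_neg hneg
      have hB : ∀ j, p.transB l (-n) j = p.freeB (-n) j := fun j => if_neg hneg
      simp only [hA, hB]
      rw [mul_comm, h, mul_comm]
  by_cases hn : IsDependent n
  · exact key n hn
  · have := key (-n) ((isDependent_neg hN).1 hn)
    rw [neg_neg] at this
    rw [mul_comm, this, mul_comm]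

theorem transA_eq_transB {n : Fin N} {j : Fin M} (hj : (j : ℕ) < s) : p.transA l n j = p.transB l n j := by
  have hfree : p.freeA n j = p.freeB n j := by
    rw [freeA, freeB, OverlapCoord.alphaIdx, dif_neg (not_le.2 hj)]
  rw [transA, transB, hfree]
  by_cases hjl : j = l
  · subst hjl
    rw [shared, if_neg (not_le.2 hj), one_mul]
  · rw [if_neg hjl, if_neg hjl]

end FrameData

theorem quad_of_mul {M : ℕ} {A : Matrix (Fin M) (Fin M) ℂ} {a : Fin M → ℂ}
    (hA : ∀ i j, A i j = a i * a j) (u : Fin M → ℂ) : quad A u = (∑ j, a j * u j) ^ 2 := by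
  rw [quad_eq_sum, sq, Finset.sum_mul_sum]
  exact Finset.sum_congr rfl fun i _ => Finset.sum_congr rfl fun j _ => by rw [hA]; ring

theorem mem_symRankLeOne_of_mul {M : ℕ} {A : Matrix (Fin M) (Fin M) ℂ} {a : Fin M → ℂ}
    (hA : ∀ i j, A i j = a i * a j) : A ∈ symRankLeOne M := by
  refine ⟨Matrix.IsSymm.ext fun i j => by rw [hA, hA, mul_comm], ?_⟩
  rw [show A = Matrix.vecMulVec a a from Matrix.ext hA]
  exact Matrix.rank_vecMulVec_le a a

/-- With `α_n = γ_n - i γ_{-n}` the sum `(a·α_n)² + (a·α_{-n})²` equals `-4i (a·γ_n)(a·γ_{-n})`, and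
likewise for `b`, so `sum_mul_sum_neg` gives the incidence equations. The hypothesis separates the
`(l, l)` entries of `A` and `B`. -/
theorem FrameData.inCone {M N s : ℕ} [NeZero N] (hN : Even N) (hN2 : 2 ≤ N)
    {l : Fin M} (p : FrameData M N s ℂ) (hne : p.a l ^ 2 ≠ p.b l ^ 2) :
    InCone M N s (p.frame l Complex.I) p.mats := by
  have hA : ∀ i j, matA p.mats i j = p.a i * p.a j := fun _ _ => rfl
  have hB : ∀ i j, matB p.mats i j = p.b i * p.b j := fun _ _ => rfl
  refine ⟨?_, mem_symRankLeOne_of_mul hA, mem_symRankLeOne_of_mul hB, ?_, ?_⟩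
  · intro n j hj
    change p.transA l n j - Complex.I * p.transA l (-n) j =
      p.transB l n j - Complex.I * p.transB l (-n) j
    rw [p.transA_eq_transB l hj, p.transA_eq_transB l hj]
  · intro h
    have := congrFun (congrFun h l) l
    rw [hA, hB] at this
    exact hne (by rw [sq, sq, this])
  · rw [incidenceEqs_iff hN hN2]
    intro n
    have hP : ∀ n, ∑ j, p.a j * alpha (p.frame l Complex.I) n j =
        (∑ j, p.a j * p.transA l n j) - Complex.I * ∑ j, p.a j * p.transA l (-n) j := by
      intro n
      rw [Finset.mul_sum, ← Finset.sum_sub_distrib]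
      refine Finset.sum_congr rfl fun j _ => ?_
      change p.a j * (p.transA l n j - Complex.I * p.transA l (-n) j) = _
      ring
    have hR : ∀ n, ∑ j, p.b j * beta (p.frame l Complex.I) n j =
        (∑ j, p.b j * p.transB l n j) - Complex.I * ∑ j, p.b j * p.transB l (-n) j := by
      intro n
      rw [Finset.mul_sum, ← Finset.sum_sub_distrib]
      refine Finset.sum_congr rfl fun j _ => ?_
      change p.b j * (p.transB l n j - Complex.I * p.transB l (-n) j) = _
      ring
    rw [quad_of_mul hA, quad_of_mul hA, quad_of_mul hB, quad_of_mul hB, hP, hP, hR, hR, neg_neg]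
    have hI := Complex.I_sq
    have h := p.sum_mul_sum_neg l hN n
    set P := ∑ j, p.a j * p.transA l n j
    set P' := ∑ j, p.a j * p.transA l (-n) j
    set R := ∑ j, p.b j * p.transB l n j
    set R' := ∑ j, p.b j * p.transB l (-n) j
    linear_combination (-4 * Complex.I) * h + (P ^ 2 + P' ^ 2 - R ^ 2 - R' ^ 2) * hI

/-! ### Counting and recovering the parameters -/

/-- The determined coordinates of the transformed frames. -/
def IsDependentCoord {M N s : ℕ} (l : Fin M) (w : OverlapCoord M N s) : Prop :=
  ∃ n, IsDependent n ∧ w = Sum.inl (n, l)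

/-- Indices of the parameters: entries of `a`, entries of `b` other than the normalised `b l`, and
coordinates of the transformed frames that are neither determined nor the normalised `ν`. -/
abbrev ParamIdx {M N s : ℕ} (l : Fin M) (ν : OverlapCoord M N s) : Type :=
  (Fin M ⊕ {j : Fin M // j ≠ l}) ⊕
    {w : OverlapCoord M N s // ¬ (w = ν ∨ IsDependentCoord l w)}

open Classical in
theorem card_paramIdx {M N s : ℕ} (hN : Even N) (hN2 : 2 ≤ N) (l : Fin M)
    {ν : OverlapCoord M N s} (hν : ¬ IsDependentCoord l ν) :
    Fintype.card (ParamIdx l ν) + 2 + (N / 2 + 1) =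
      2 * M + Fintype.card (OverlapCoord M N s) := by
  have hfix : Fintype.card {w : OverlapCoord M N s // w = ν ∨ IsDependentCoord l w} =
      N / 2 + 2 := by
    rw [Fintype.card_subtype, show (Finset.univ.filter fun w : OverlapCoord M N s =>
      w = ν ∨ IsDependentCoord l w) = insert ν
        ((Finset.univ.filter fun n : Fin N => IsDependent n).image fun n => Sum.inl (n, l)) from ?_,
      Finset.card_insert_of_notMem, Finset.card_image_of_injective, card_filter_isDependent hN hN2]
    · intro n m h
      simpa using h
    · simp only [Finset.mem_image, Finset.mem_filter, Finset.mem_univ, true_and]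
      rintro ⟨n, hn, h⟩
      exact hν ⟨n, hn, h.symm⟩
    · ext w
      simp [IsDependentCoord, eq_comm]
  have h1 := Fintype.card_subtype_compl fun w : OverlapCoord M N s =>
    w = ν ∨ IsDependentCoord l w
  have h2 := Fintype.card_subtype_le fun w : OverlapCoord M N s =>
    w = ν ∨ IsDependentCoord l w
  have h3 := l.2
  rw [Fintype.card_sum, Fintype.card_sum, Fintype.card_fin, h1, hfix,
    Fintype.card_subtype_compl, Fintype.card_fin, Fintype.card_unique]
  omega

open Classical in
/-- The parameters as polynomials. -/
noncomputable def genericData {M N s : ℕ} (l : Fin M) (ν : OverlapCoord M N s) :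
    FrameData M N s (MvPolynomial (ParamIdx l ν) ℂ) where
  coord w := if h : w = ν ∨ IsDependentCoord l w then (if w = ν then 1 else 0)
    else MvPolynomial.X (Sum.inr ⟨w, h⟩)
  a j := MvPolynomial.X (Sum.inl (Sum.inl j))
  b j := if h : j = l then 1 else MvPolynomial.X (Sum.inl (Sum.inr ⟨j, h⟩))

open Classical in
/-- Parameters at which all the pivots are equal to one. -/
noncomputable def baseParam {M N s : ℕ} (l : Fin M) (ν : OverlapCoord M N s) :
    ParamIdx l ν → ℂ :=
  Sum.elim 0 fun w => if ∃ n, ¬ IsDependent n ∧ w.1 = Sum.inl (n, l) then 1 else 0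

open Classical in
-- `hν'` places `ν` in a free column whenever there is one. Then `ν` carries no pivot factor and can
-- be compared directly with the entries whose base value is `1`.
theorem card_paramIdx_le_zariskiDim {M N s : ℕ} [NeZero N] (hN : Even N) (hN2 : 2 ≤ N)
    {l : Fin M} (hl : (l : ℕ) = M - 1)
    {ν : OverlapCoord M N s} (hν : ¬ IsDependentCoord l ν)
    (hν' : ∀ n : Fin N, ¬ IsDependent n → ∃ m, ¬ IsDependent m ∧ ν = Sum.inl (m, l)) :
    (Fintype.card (ParamIdx l ν) : WithBot ℕ∞) ≤ zariskiDim (incidenceVariety M N s) := by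
  let p := genericData l ν
  let P : (ParamIdx l ν → ℂ) → FrameData M N s ℂ := fun t => p.map (MvPolynomial.eval t)
  -- As `b l = 1`, the first factor ensures `A ≠ B`; nonzero pivots make the scaled entries
  -- recoverable.
  let D : MvPolynomial (ParamIdx l ν) ℂ :=
    (1 - p.a l ^ 2) * ∏ n : Fin N, if IsDependent n then p.pivot l n else 1
  have hD : ∀ t, MvPolynomial.eval t D ≠ 0 ↔
      1 - (P t).a l ^ 2 ≠ 0 ∧ ∀ n, IsDependent n → (P t).pivot l n ≠ 0 := by
    intro t
    rw [map_mul, mul_ne_zero_iff, map_prod, Finset.prod_ne_zero_iff, map_sub, map_pow, map_one]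
    refine and_congr Iff.rfl (forall_congr' fun n => ?_)
    split_ifs with h
    · simp [h, FrameData.map_pivot, P]
    · simp [h]
  have hb : ∀ t, (P t).b l = 1 := fun t => by simp [P, p, FrameData.map, genericData]
  have hcoordν : ∀ t, (P t).coord ν = 1 := fun t => by simp [P, p, FrameData.map, genericData]
  have hcoord : ∀ t w (h : ¬ (w = ν ∨ IsDependentCoord l w)),
      (P t).coord w = t (Sum.inr ⟨w, h⟩) := by
    intro t w h
    simp only [P, p, FrameData.map, genericData, dif_neg h, MvPolynomial.eval_X]
  let g : FrameCoord M N ⊕ MatCoord M → MvPolynomial (ParamIdx l ν) ℂ :=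
    Sum.elim (p.frame l (MvPolynomial.C Complex.I)) p.mats
  have hg1 : ∀ t v, MvPolynomial.eval t (g (Sum.inl v)) = (P t).frame l Complex.I v := by
    intro t v
    refine (p.map_frame l (MvPolynomial.eval t) _ v).trans ?_
    rw [MvPolynomial.eval_C]
  have hg2 : ∀ t v, MvPolynomial.eval t (g (Sum.inr v)) = (P t).mats v :=
    fun t v => p.map_mats (MvPolynomial.eval t) v
  let side : OverlapCoord M N s → Fin N × Fin M → FrameCoord M N :=
    Sum.elim (fun _ => Sum.inr) (fun _ => Sum.inl)
  -- The inverse transformation: `α_n + i α_{-n} = 2 γ_n`, and similarly for `β`.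
  let Lf : OverlapCoord M N s → MvPolynomial (FrameCoord M N ⊕ MatCoord M) ℂ := fun w =>
    MvPolynomial.X (Sum.inl (side w w.pos)) + MvPolynomial.C Complex.I *
      MvPolynomial.X (Sum.inl (side w (-w.pos.1, w.pos.2)))
  have hLf : ∀ w, IsBihomogeneous (Lf w) 1 0 := fun w =>
    (isBihomogeneous_X_inl _).add ((isBihomogeneous_X_inl _).C_mul _)
  let scale : (ParamIdx l ν → ℂ) → OverlapCoord M N s → ℂ := fun t w =>
    if IsDependent w.pos.1 then (P t).pivot l w.pos.1 else 1
  have hLeval : ∀ t w, ¬ IsDependentCoord l w →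
      MvPolynomial.eval (fun v => MvPolynomial.eval t (g v)) (Lf w) =
        2 * (scale t w * (P t).coord w) := by
    intro t w hw
    have hI := Complex.I_sq
    simp only [Lf, map_add, map_mul, MvPolynomial.eval_X, MvPolynomial.eval_C, hg1]
    rcases w with ⟨n, j⟩ | ⟨⟨n, j⟩, hj⟩
    · have h1 : (P t).transB l n j = scale t (Sum.inl (n, j)) * (P t).coord (Sum.inl (n, j)) := by
        change _ = (if IsDependent n then (P t).pivot l n else 1) * (P t).freeB n j
        rw [FrameData.transB]
        split_ifs with h2 h3
        · exact absurd ⟨n, h2, by rw [h3]⟩ hw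
        · rw [add_zero]
        · rw [one_mul]
      rw [← h1]
      simp only [side, OverlapCoord.pos, Sum.elim_inl, FrameData.frame, Sum.elim_inr, id, neg_neg]
      linear_combination (-(P t).transB l n j) * hI
    · have h0 : (P t).freeA n j = (P t).coord (Sum.inr ⟨(n, j), hj⟩) := by
        rw [FrameData.freeA, OverlapCoord.alphaIdx, dif_pos hj]
      have h1 : (P t).transA l n j =
          scale t (Sum.inr ⟨(n, j), hj⟩) * (P t).coord (Sum.inr ⟨(n, j), hj⟩) := by
        -- Since `l` is the last row, any unshared row forces `l` to be unshared; the determined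
        -- entry then belongs to `δ` only and `γ` gets no correction.
        have hj' : s ≤ (l : ℕ) := by
          have := j.2
          have : s ≤ (j : ℕ) := hj
          omega
        change _ = (if IsDependent n then (P t).pivot l n else 1) *
          (P t).coord (Sum.inr ⟨(n, j), hj⟩)
        rw [FrameData.transA, h0, FrameData.shared, if_pos hj', zero_mul, ite_self, add_zero]
        split_ifs
        · rfl
        · rw [one_mul]
      rw [← h1]
      simp only [side, OverlapCoord.pos, Sum.elim_inl, FrameData.frame, Sum.elim_inr, neg_neg]
      linear_combination (-(P t).transA l n j) * hI
  have hscale : ∀ t, MvPolynomial.eval t D ≠ 0 → ∀ w, scale t w ≠ 0 := by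
    intro t ht w
    simp only [scale]
    split_ifs with h
    · exact ((hD t).1 ht).2 _ h
    · exact one_ne_zero
  have hLν : ∀ t, MvPolynomial.eval t D ≠ 0 →
      MvPolynomial.eval (fun v => MvPolynomial.eval t (g v)) (Lf ν) ≠ 0 := by
    intro t ht
    rw [hLeval t ν hν, hcoordν]
    simpa using hscale t ht ν
  refine card_le_zariskiDim _ g D (baseParam l ν) ?_ ?_ ?_
  · have ha : ∀ j, (P (baseParam l ν)).a j = 0 := fun j => by
      simp [P, p, FrameData.map, genericData, baseParam]
    refine (hD _).2 ⟨by simp [ha], fun n hn => ?_⟩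
    have hB : (P (baseParam l ν)).factorB n = 1 := by
      rw [FrameData.factorB]
      split_ifs with h
      · rfl
      · have hn' := (isDependent_neg hN).2 hn h
        rw [Finset.sum_eq_single l, hb, one_mul, FrameData.freeB]
        · by_cases h1 : (Sum.inl (-n, l) : OverlapCoord M N s) = ν
          · rw [h1, hcoordν]
          · have h2 : ¬ IsDependentCoord l (Sum.inl (-n, l) : OverlapCoord M N s) := by
              rintro ⟨m, hm, h⟩
              rw [Sum.inl.injEq, Prod.mk.injEq] at h
              exact hn' (h.1 ▸ hm)
            rw [hcoord _ _ (not_or.2 ⟨h1, h2⟩), baseParam, Sum.elim_inr, if_pos ⟨-n, hn', rfl⟩]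
        · intro j _ hj
          simp [P, p, FrameData.map, genericData, baseParam, hj]
        · simp
    rw [FrameData.pivot, hB, hb, ha]
    simp
  · intro t ht
    have hx : (fun i => MvPolynomial.eval t (g (Sum.inl i))) ≠ 0 := by
      intro h
      apply hLν t ht
      have h' : ∀ i, MvPolynomial.eval t (g (Sum.inl i)) = 0 := fun i => congrFun h i
      simp [Lf, h']
    have hy : (fun j => MvPolynomial.eval t (g (Sum.inr j))) ≠ 0 := by
      intro h
      have h' := congrFun h (Sum.inr (l, l))
      rw [hg2] at h'
      simp [FrameData.mats, hb] at h'
    refine ⟨hx, hy, (mk_mem_incidenceVariety hx hy).2 ?_⟩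
    simp only [hg1, hg2]
    refine (P t).inCone hN hN2 ?_
    rw [hb, one_pow]
    exact fun h => ((hD t).1 ht).1 (by rw [h, sub_self])
  · rintro ((j | ⟨j, hj⟩) | ⟨w, hw⟩)
    -- The matrices see `a` only up to sign. At the base value `0` this does no harm, since `a j ^ 2
    -- = 0` forces `a j = 0`; the same holds for `b j`.
    · refine ⟨_, _, _, isBihomogeneous_X_inr (Sum.inl (j, j)), fun t _ => ?_⟩
      rw [MvPolynomial.eval_X, hg2]
      simp [P, p, FrameData.mats, FrameData.map, genericData, baseParam]
    · refine ⟨_, _, _, isBihomogeneous_X_inr (Sum.inr (j, j)), fun t _ => ?_⟩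
      rw [MvPolynomial.eval_X, hg2]
      simp [P, p, FrameData.mats, FrameData.map, genericData, baseParam, hj]
    · let c := baseParam l ν (Sum.inr ⟨w, hw⟩)
      refine ⟨_, _, _, (hLf w).add ((hLf ν).C_mul (-c)), fun t ht => ?_⟩
      rw [map_add, map_mul, MvPolynomial.eval_C, hLeval t w (not_or.1 hw).2, hLeval t ν hν,
        hcoord t w hw, hcoordν]
      change _ ↔ _ = c
      -- For base value `1` the test compares `w` with `ν`, both of scale `1`; for base value `0` it
      -- is the vanishing of `Lf w`, and any nonzero scale will do.
      by_cases hc : ∃ n, ¬ IsDependent n ∧ w = Sum.inl (n, l)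
      · have hc1 : c = 1 := if_pos hc
        obtain ⟨n, hn, hwn⟩ := hc
        obtain ⟨m, hm, hνm⟩ := hν' n hn
        have h1 : scale t w = 1 := by
          rw [hwn]
          exact if_neg hn
        have h2 : scale t ν = 1 := by
          rw [hνm]
          exact if_neg hm
        rw [h1, h2, hc1]
        constructor
        · intro h
          linear_combination h / 2
        · intro h
          linear_combination 2 * h
      · have hc0 : c = 0 := if_neg hc
        rw [hc0]
        simp [hscale t ht w]

/-- Outside the excluded case there is a coordinate that can be normalised. -/
theorem exists_normalising_coord {M N s : ℕ} (hM : 1 ≤ M) (hN : Even N) (hN2 : 2 ≤ N)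
    (hs : s ≤ M) (hdeg : ¬ (M = 1 ∧ s = 1 ∧ N = 2)) {l : Fin M} (hl : (l : ℕ) = M - 1) :
    ∃ ν : OverlapCoord M N s, ¬ IsDependentCoord l ν ∧
      ∀ n : Fin N, ¬ IsDependent n → ∃ m, ¬ IsDependent m ∧ ν = Sum.inl (m, l) := by
  by_cases h4 : 4 ≤ N
  · have h1 : ¬ IsDependent (⟨1, by omega⟩ : Fin N) := by
      simp only [IsDependent]
      omega
    refine ⟨Sum.inl (⟨1, by omega⟩, l), ?_, fun _ _ => ⟨_, h1, rfl⟩⟩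
    rintro ⟨m, hm, h⟩
    rw [Sum.inl.injEq, Prod.mk.injEq] at h
    exact h1 (h.1 ▸ hm)
  have hN' : N = 2 := by
    obtain ⟨m, rfl⟩ := hN
    omega
  have hall : ∀ n : Fin N, IsDependent n := by
    intro n
    have := n.2
    unfold IsDependent
    omega
  -- For `N = 2` both columns are dependent, so `ν` must avoid the entries `δ_{n,l}`: it lies in
  -- another row, or in `γ` when `M = 1` and `s = 0`. In the excluded case no other entry exists.
  by_cases hM2 : 2 ≤ M
  · refine ⟨Sum.inl (⟨0, by omega⟩, ⟨0, by omega⟩), ?_, fun n hn => absurd (hall n) hn⟩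
    rintro ⟨m, hm, h⟩
    rw [Sum.inl.injEq, Prod.mk.injEq] at h
    have := congrArg Fin.val h.2
    simp only at this
    omega
  · refine ⟨Sum.inr ⟨(⟨0, by omega⟩, l), by simp only; omega⟩, ?_, fun n hn => absurd (hall n) hn⟩
    rintro ⟨m, hm, h⟩
    exact absurd h (by simp)

end OverlapIncidence

theorem mainTheorem10 (M N s : ℕ) (hM : 1 ≤ M) (hN : Even N) (hN2 : 2 ≤ N) (hs : s ≤ M)
    (hdeg : ¬ (M = 1 ∧ s = 1 ∧ N = 2)) :
    ∃ d : ℕ,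
      OverlapIncidence.zariskiDim (OverlapIncidence.incidenceVariety M N s) = (d : WithBot ℕ∞) ∧
      (d : ℚ) = 2 * M * N + 2 * M - N / 2 - s * N - 3 := by
  classical
  have : NeZero N := ⟨by omega⟩
  let l : Fin M := ⟨M - 1, by omega⟩
  obtain ⟨ν, hν, hν'⟩ :=
    OverlapIncidence.exists_normalising_coord (s := s) hM hN hN2 hs hdeg (l := l) rfl
  have hcard := OverlapIncidence.card_paramIdx hN hN2 l hν
  refine ⟨Fintype.card (OverlapIncidence.ParamIdx l ν), le_antisymm
    (OverlapIncidence.zariskiDim_incidenceVariety_le hM hN hN2 hcard.ge)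
    (OverlapIncidence.card_paramIdx_le_zariskiDim hN hN2 rfl hν hν'), ?_⟩
  rw [OverlapIncidence.card_overlapCoord hs] at hcard
  obtain ⟨m, rfl⟩ := hN
  obtain ⟨k, rfl⟩ := Nat.exists_eq_add_of_le hs
  rw [show (m + m) / 2 = m by omega, Nat.add_sub_cancel_left] at hcard
  have h := congrArg (Nat.cast : ℕ → ℚ) hcard
  push_cast at h ⊢
  linear_combination h
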